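/- **Setting.** Let $\mathbb T$ be the unit circle, $h(z)=z^2$, and fix $\alpha\in\mathbb T$. Let $\star_1$ be the square root of $\alpha$ with argument in $[0,\pi)$ and $\star_2=-\star_1$. A point $x$ has letter $\star$ if $x\in\{\star_1,\star_2\}$, letter $L$ if it lies in the open half circle running counterclockwise from $\star_1$ to $\star_2$, and letter $R$ otherwise. The itinerary $I^\alpha(x)$ is the infinite word whose $n$-th digit ($n\ge1$) is the letter of $h^{n-1}(x)$. Write $x\approx_\alpha y$ if at every position $I^\alpha(x)$ and $I^\alpha(y)$ agree or at least one of them has the letter $\star$. For $X\in\{L,R\}$ let $\widetilde X$ be the inverse branch of $h$ on $\mathbb T\setminus\{\alpha\}$ with values in the open half circle $X$, and for a word $u=u_1\cdots u_n$ let $\widetilde u=\widetilde{u_1}\circ\cdots\circ\widetilde{u_n}$. *Recurrence conditions.* A set $S\subseteq\mathbb N$ is $D$-rare if $\#(S\cap[i,i+D])\le3$ for all $i$. The $i$-th digit of $w=I^\alpha(\alpha)|_{[1,n]}$ is $(D,S)$-duplicating if there is an interval $[a,b]$ with $2\le a\le i\le b\le n$ such that $w[j]=I^\alpha(\alpha)[j-a+1]$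 for all $j\in[a,b]\setminus S$, and either $b=n$ or $[a,b]$ has more than $D$ digits. The point $\alpha$ is *strongly recurrent* if for every integer $D>0$ and every $\tau<1$ there are $n>D$ and a $D$-rare set $S\subseteq\{1,\dots,n\}$ such that more than $\tau n$ digits of $I^\alpha(\alpha)|_{[1,n]}$ are $(D,S)$-duplicating. It is *weakly pre-periodic* if there are integers $k,m\ge1$ such that $I^\alpha(\alpha)[m+kn]$ is the same letter for all $n\ge0$. *Generalized cylinder sets.* Let $\mathcal{GCS}_n$ be the collection of the closures in $\mathbb T$ of the sets $\Omega\cap\mathbb T$, where $\Omega$ runs over the connected components of the closed unit disc minus the hyperbolic geodesics (with their end points) joining $\widetilde u(\star_1)$ to $\widetilde u(\star_2)$, over all words $u\in\{L,R\}^n$. When exactly one member of $\mathcal{GCS}_n$ contains $x$, it is denoted $GCS_n(x)$. *Digit-fixing covers.* A *gluing link* is a finite union of disjoint closed arcs $[a_1,b_1],\dots,[a_m,b_m]$, with $m\ge1$ and end points listed counterclockwise, such that $b_i\approx_\alpha a_{i+1}$ for all $i$ (with $a_{m+1}=a_1$). Let $\{D(x)\}_{x\in\mathbb T}$ be a family of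 gluing links with $x\in D(x)$. Put $D^{(0)}(x)=D(x)$, and let $D^{(n+1)}(x)$ be the component containing $x$ of $h^{-1}(E)$, where $E=D^{(n)}(h(x))$: this component is all of $h^{-1}(E)$ if $\alpha\in E$, and otherwise it is the one of the two sets $\widetilde L(E),\widetilde R(E)$ that contains $x$. The family is an *$N$-digit-fixing cover* if for all $n\ge0$, all $y\in\mathbb T$ and all $x_1,x_2\in D^{(n)}(y)$, any two distinct positions in $[1,n+1]$ at which $I^\alpha(x_1)$ and $I^\alpha(x_2)$ differ are more than $N$ apart. **Proposition.** Let $\alpha\in\mathbb T$ be neither strongly recurrent nor weakly pre-periodic. Then for every integer $N\ge0$ there is an integer $K>0$ such that: 1. for every $n\ge K$ there is exactly one member $GCS_n(\alpha)$ of $\mathcal{GCS}_n$ containing $\alpha$, and $$GCS_n(\alpha)\cap\{h^i(\alpha):1\le i\le N\}=\emptyset;$$ 2. every $x\in\mathbb T$ lies in some member of $\mathcal{GCS}_K\cup\mathcal{GCS}_{K+1}$, and every family $\{C^K(x)\}_{x\in\mathbb T}$ with $x\in C^K(x)\in\mathcal{GCS}_K\cup\mathcal{GCS}_{K+1}$ for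 all $x$ is an $N$-digit-fixing cover of $\mathbb T$ by gluing links. -/

import Mathlib

noncomputable section

namespace QuadLam

/-- The two letters of the alphabet of inverse branches. -/
inductive Letter where
  | L
  | R

/-- The map `h z = z ^ 2` on the unit circle. -/
def hop (z : Circle) : Circle := z ^ 2

/-- The square root of `z` whose argument lies in `[0, π)`. -/
def root (z : Circle) : Circle :=
  Circle.exp (toIcoMod Real.two_pi_pos 0 (Complex.arg (z : ℂ)) / 2)

theorem hop_root (z : Circle) : hop (root z) = z := by
  have h1 : Circle.exp (toIcoMod Real.two_pi_pos 0 (Complex.arg (z : ℂ))) = z := by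
    rw [← self_sub_toIcoDiv_zsmul]
    have := Circle.periodic_exp.sub_zsmul_eq
      (x := Complex.arg (z : ℂ)) (toIcoDiv Real.two_pi_pos 0 (Complex.arg (z : ℂ)))
    rw [this, Circle.exp_arg]
  unfold hop root
  rw [pow_two, ← Circle.exp_add, add_halves, h1]

/-- `⋆₁`, the first square root of `α`, counterclockwise from `1`. -/
def star₁ (α : Circle) : Circle := root α

/-- `⋆₂ = -⋆₁`, the second square root of `α`. -/
def star₂ (α : Circle) : Circle := -root α

/-- The letter of a point: `none` stands for the symbol `⋆` and marks the two square roots of `α`;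
`L` marks the open half circle running counterclockwise from `⋆₁` to `⋆₂`, and `R` the one running
from `⋆₂` to `⋆₁`. -/
def letter (α x : Circle) : Option Letter :=
  open Classical in
  if hop x = α then none
  else if 0 < ((x / star₁ α : Circle) : ℂ).im then some Letter.L else some Letter.R

/-- The `n`-th digit (`n ≥ 1`) of the itinerary of `x` with respect to `α`. -/
def itin (α x : Circle) (n : ℕ) : Option Letter := letter α (hop^[n - 1] x)

/-- The relation `x ≈_α y`: at every position the two itineraries agree or one of them shows `⋆`. -/
def Glued (α x y : Circle) : Prop :=
  ∀ n, 1 ≤ n → itin α x n = itin α y n ∨ itin α x n = none ∨ itin α y n = none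

/-- The inverse branch of `hop` on the circle without `α` with values in the open half circle of
the given letter (the value at `α` is irrelevant). -/
def branch (α : Circle) (l : Letter) (y : Circle) : Circle :=
  open Classical in
  if letter α (root y) = some l then root y else -root y

/-- For a finite word `u = u₁ u₂ ⋯ uₙ`, the composition of the inverse branches,
that of `u₁` outermost. -/
def wordMap (α : Circle) (u : List Letter) (x : Circle) : Circle :=
  u.foldr (branch α) x

/-! ### Recurrence conditions -/

/-- The digits in `[a, b]` of the word `g` coincide with the first `b - a + 1` digits of the
itinerary of `α`, except possibly at positions in `S`. -/
def IsDuplicatingInterval (α : Circle) (S : Set ℕ) (g : ℕ → Option Letter) (a b : ℕ) : Prop :=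
  ∀ j, a ≤ j → j ≤ b → j ∉ S → g j = itin α α (j - a + 1)

/-- The `i`-th digit of the word formed by the first `n` digits of the itinerary of `α` is
`(D, S)`-duplicating: it is covered by an `S`-duplicating interval which contains the last digit or
has more than `D` digits. The interval must start after the first digit, since the interval of all
`n` digits duplicates itself trivially. -/
def IsDuplicatingDigit (α : Circle) (D : ℕ) (S : Set ℕ) (n i : ℕ) : Prop :=
  ∃ a b, 2 ≤ a ∧ a ≤ i ∧ i ≤ b ∧ b ≤ n ∧ IsDuplicatingInterval α S (itin α α) a b ∧
    (b = n ∨ D < b - a + 1)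

/-- `S` has at most three elements in any interval `[i, i + D]`. -/
def IsRare (D : ℕ) (S : Set ℕ) : Prop := ∀ i, (S ∩ Set.Icc i (i + D)).encard ≤ 3

def StronglyRecurrent (α : Circle) : Prop :=
  ∀ D : ℕ, 0 < D → ∀ τ : ℝ, τ < 1 → ∃ n : ℕ, D < n ∧ ∃ S : Set ℕ, S ⊆ Set.Icc 1 n ∧ IsRare D S ∧
    τ * n < ({i | 1 ≤ i ∧ i ≤ n ∧ IsDuplicatingDigit α D S n i}.ncard : ℝ)

/-- The itinerary of `α` is constant along an infinite arithmetic progression. -/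
def WeaklyPreperiodic (α : Circle) : Prop :=
  ∃ k m : ℕ, 1 ≤ k ∧ 1 ≤ m ∧ ∃ c : Option Letter, ∀ n : ℕ, itin α α (m + k * n) = c

/-! ### Generalized cylinder sets -/

/-- The hyperbolic geodesic of the closed unit disc, end points included, joining two distinct
points `a`, `b` of the unit circle: the part in the disc of the circle or line through `a` and `b`
that is orthogonal to the unit circle. See `mem_geodesic_iff` and `mem_geodesic_antipodal_iff`. -/
def geodesic (a b : Circle) : Set ℂ :=
  {z | ‖z‖ ≤ 1 ∧
    (1 + ‖z‖ ^ 2) / 2 * ((b : ℂ) * star (a : ℂ)).im + (z * star ((b : ℂ) - a)).im = 0}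

theorem mem_geodesic_iff {a b : Circle} (hab : a ≠ b) (hab' : a ≠ -b) (z : ℂ) :
    z ∈ geodesic a b ↔ ‖z‖ ≤ 1 ∧
      ‖z - 2 * a * b / (a + b)‖ ^ 2 = ‖(2 * a * b / (a + b) : ℂ)‖ ^ 2 - 1 := by
  have ha := a.normSq_coe
  have hb := b.normSq_coe
  have hne : (a : ℂ) ≠ b := fun h => hab (Circle.ext h)
  have hne' : (a : ℂ) + b ≠ 0 := fun h => hab' (Circle.ext (by
    rw [Circle.coe_neg]; exact eq_neg_of_add_eq_zero_left h))
  have h1 : 0 < Complex.normSq ((a : ℂ) - b) := Complex.normSq_pos.2 (sub_ne_zero.2 hne)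
  have h2 : 0 < Complex.normSq ((a : ℂ) + b) := Complex.normSq_pos.2 hne'
  have hc : (2 * a * b / (a + b) : ℂ) = (2 / Complex.normSq ((a : ℂ) + b) : ℝ) * (a + b) := by
    have e1 : (a : ℂ) * starRingEnd ℂ a = 1 := by rw [Complex.mul_conj, ha]; simp
    have e2 : (b : ℂ) * starRingEnd ℂ b = 1 := by rw [Complex.mul_conj, hb]; simp
    have e3 := Complex.mul_conj ((a : ℂ) + b)
    have h2' : ((Complex.normSq ((a : ℂ) + b) : ℝ) : ℂ) ≠ 0 := by exact_mod_cast h2.ne'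
    push_cast
    rw [div_mul_eq_mul_div, div_eq_div_iff hne' h2', ← e3, map_add]
    linear_combination (2 * b * (a + b)) * e1 + (2 * a * (a + b)) * e2
  rw [hc]
  simp only [geodesic, Set.mem_ofPred_eq, ← Complex.normSq_eq_norm_sq]
  refine and_congr_right fun _ => ?_
  generalize (a : ℂ) = A at *
  generalize (b : ℂ) = B at *
  obtain ⟨p, q⟩ := A
  obtain ⟨r, s⟩ := B
  obtain ⟨x, y⟩ := z
  simp only [Complex.normSq_apply, Complex.add_re, Complex.add_im, Complex.sub_re, Complex.sub_im,
    Complex.mul_im, Complex.mul_re, Complex.star_def, Complex.conj_re, Complex.conj_im,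
    Complex.ofReal_re, Complex.ofReal_im] at *
  set w := (p + r) * (p + r) + (q + s) * (q + s) with hw
  have hk : s * p - r * q ≠ 0 := by
    intro h
    have : ((p - r) * (p - r) + (q - s) * (q - s)) * w = 0 := by
      rw [hw]
      linear_combination (4 * (s * p - r * q)) * h + (p * p + q * q - r * r - s * s) * (ha - hb)
    exact (mul_pos h1 h2).ne' this
  have hw2 : w = 2 + 2 * (p * r + q * s) := by rw [hw]; linear_combination ha + hb
  have e1 : (s - q) * w = 2 * (s * p - r * q) * (p + r) := by
    rw [hw2]; linear_combination (2 * q) * hb - (2 * s) * ha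
  have e2 : (r - p) * w = -2 * (s * p - r * q) * (q + s) := by
    rw [hw2]; linear_combination (2 * p) * hb - (2 * r) * ha
  have key : w * ((1 + (x * x + y * y)) / 2 * (s * p - r * q) + (y * (r - p) - x * (s - q))) =
      (s * p - r * q) * (w * (1 + (x * x + y * y)) / 2 - 2 * (x * (p + r) + y * (q + s))) := by
    linear_combination y * e2 - x * e1
  have hw0 : w ≠ 0 := h2.ne'
  constructor
  · intro h
    have h' : w * (1 + (x * x + y * y)) / 2 - 2 * (x * (p + r) + y * (q + s)) = 0 := by
      refine (mul_eq_zero.1 (key.symm.trans ?_)).resolve_left hk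
      linear_combination w * h
    field_simp
    linear_combination (2 * w) * h'
  · intro h
    field_simp at h
    have h' : w * (w * (1 + (x * x + y * y)) / 2 - 2 * (x * (p + r) + y * (q + s))) = 0 := by
      linear_combination h / 2
    have h3 := (mul_eq_zero.1 h').resolve_left hw0
    rw [h3, mul_zero] at key
    have h4 := (mul_eq_zero.1 key).resolve_left hw0
    linear_combination h4

theorem mem_geodesic_antipodal_iff (a : Circle) (z : ℂ) :
    z ∈ geodesic a (-a) ↔ ‖z‖ ≤ 1 ∧ (z * star (a : ℂ)).im = 0 := by
  refine and_congr_right fun _ => ?_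
  rw [Circle.coe_neg]
  generalize (a : ℂ) = A
  simp only [Complex.mul_im, Complex.neg_re, Complex.neg_im, Complex.sub_re, Complex.sub_im,
    Complex.star_def, Complex.conj_re, Complex.conj_im]
  constructor <;> intro h <;> linarith

/-- The closed unit disc cut along the geodesics joining the images of `⋆₁` and `⋆₂` under the
inverse branches of all words of length `n`. -/
def cutDisc (α : Circle) (n : ℕ) : Set ℂ :=
  Metric.closedBall 0 1 \
    ⋃ u ∈ {u : List Letter | u.length = n},
      geodesic (wordMap α u (star₁ α)) (wordMap α u (star₂ α))

/-- The generalized cylinder sets of degree `n`: the (closed) traces on the unit circle of the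
connected components of the cut disc. -/
def GCS (α : Circle) (n : ℕ) : Set (Set Circle) :=
  {S | ∃ z ∈ cutDisc α n,
    S = closure {x : Circle | (x : ℂ) ∈ connectedComponentIn (cutDisc α n) z}}

/-! ### Gluing links and digit-fixing covers -/

/-- A gluing link: a finite union of disjoint closed arcs from `exp (i sⱼ)` counterclockwise to
`exp (i tⱼ)`, `j < n`, listed counterclockwise, such that the end of each arc is glued to the
beginning of the next one, cyclically. -/
def IsGluingLink (α : Circle) (D : Set Circle) : Prop :=
  ∃ (n : ℕ) (s t : ℕ → ℝ), s n = s 0 + 2 * Real.pi ∧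
    (∀ j < n, s j ≤ t j ∧ t j < s (j + 1) ∧
      Glued α (Circle.exp (t j)) (Circle.exp (s (j + 1)))) ∧
    D = ⋃ j < n, Circle.exp '' Set.Icc (s j) (t j)

/-- The component containing `x` of the preimage of a gluing link `D` with `hop x ∈ D`: the whole
preimage if `α ∈ D`; otherwise the preimage splits into its parts in the two half circles, which
are the images of `D` under the two inverse branches. -/
def pullback (α : Circle) (D : Set Circle) (x : Circle) : Set Circle :=
  {y | hop y ∈ D ∧ (α ∈ D ∨ letter α y = letter α x)}

/-- The component containing `x` of the `n`-th preimage of `D (hop^[n] x)`. -/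
def pullbackCover (α : Circle) (D : Circle → Set Circle) : ℕ → Circle → Set Circle
  | 0, x => D x
  | n + 1, x => pullback α (pullbackCover α D n (hop x)) x

/-- The family `D` is an `N`-digit-fixing cover of the circle by gluing links: the itineraries of
two points of the same set of the `n`-th pulled back cover, up to position `n + 1`, differ only at
positions any two of which are more than `N` apart. -/
structure IsDigitFixingCover (α : Circle) (N : ℕ) (D : Circle → Set Circle) : Prop where
  gluing : ∀ x, IsGluingLink α (D x)
  mem : ∀ x, x ∈ D x
  fixing : ∀ (n : ℕ) (y x₁ x₂ : Circle),
    x₁ ∈ pullbackCover α D n y → x₂ ∈ pullbackCover α D n y →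
    ∀ i j, 1 ≤ i → i < j → j ≤ n + 1 →
      itin α x₁ i ≠ itin α x₂ i → itin α x₁ j ≠ itin α x₂ j → N < j - i

end QuadLam

end

namespace QuadLam

/-! ### Combinatorics of return levels -/

/-! Everything rests on one claim, `eventually_not_sameSide`: each `hop^[i] α` with `1 ≤ i` is
separated from `α` by a geodesic of every sufficiently large level. Given the claim, take `K` beyond
which this holds for all `i ≤ N`. Components of the cut disc are determined by sides, and
aperiodicity keeps the orbit of `α` off the end points, which gives the first part. If two points of
a pulled-back set differ at positions `i < j`, then `α` lies in its image after `i` steps and, apart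
from a variant at the last digit, again after `j` steps. So `hop^[j - i] α` and `α` are unseparated
at a large level, and `j - i > N`.

For the claim, say that level `m` returns to level `l` if `hop^[m - l] α` and `α` are unseparated at
level `l`. Two points unseparated at level `q + 1` but with different letters have images
unseparated from `α` at level `q`. Hence, while a return lasts, every disagreement between the
itinerary of `α` and its shift creates a further return. `exists_constant_progression_of_frequently`
shows that infinitely many returns of one gap then force an itinerary that is constant along an
arithmetic progression.

There, let `c` be the least gap occurring at infinitely many levels, and consider runs of returns of
gap `c`. If arbitrarily long runs keep occurring, a progression of step `c` appears directly.
Otherwise fix the maximal recurring run length and pass to a limit set `Q` of return depths.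
Positions where the word deviates from its `c`-periodic continuation translate runs of `Q` to runs
of `Q` (`IsCoherent.run_add`). If their gcd were 1, `Q` would contain too long a run; so the gcd `k`
exceeds 1 (or nothing deviates), and positions `1 + c * k * n` never deviate. -/

theorem apply_add_mod_last_eq {A : Type*} (f : ℕ → A) (e s : ℕ)
    (h : ∀ i < e, f ((s + i) % (e + 1)) = f i) : f ((s + e) % (e + 1)) = f e := by
  classical
  let p : ℕ → Prop := fun i => f (i % (e + 1)) = f e
  have hp : Function.Periodic p (e + 1) := by
    intro i
    simp [p]
  -- Both windows are full periods, so they contain the value `f e` equally often. Their first `e`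
  -- terms match, hence so do the last ones.
  have h1 := Nat.filter_Ico_card_eq_of_periodic s (e + 1) p hp
  have h2 := Nat.filter_Ico_card_eq_of_periodic 0 (e + 1) p hp
  rw [← h2, Finset.card_filter, Finset.card_filter, Finset.sum_Ico_eq_sum_range,
    Finset.sum_Ico_eq_sum_range] at h1
  simp only [zero_add, add_tsub_cancel_left, tsub_zero, Finset.sum_range_succ] at h1
  have h3 : ∑ i ∈ Finset.range e, (if p (s + i) then 1 else 0) =
      ∑ i ∈ Finset.range e, (if p i then 1 else 0) := by
    refine Finset.sum_congr rfl fun i hi => ?_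
    have hi' := Finset.mem_range.1 hi
    simp only [p, h i hi', Nat.mod_eq_of_lt (hi'.trans (Nat.lt_succ_self e))]
  have h4 : p e := by simp [p]
  rw [h3, if_pos h4] at h1
  by_contra h5
  rw [if_neg (show ¬ p (s + e) from h5)] at h1
  have h6 : (∑ i ∈ Finset.range e, (if p i then 1 else 0)) + 0 =
      (∑ i ∈ Finset.range e, (if p i then 1 else 0)) + 1 := h1
  omega

/-- A set `Q` of times such that, at every time outside `Q`, all copies of the word `w` started at
earlier times of `Q` show the same letter. -/
def IsCoherent {A : Type*} (w : ℕ → A) (Q : Set ℕ) : Prop :=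
  ∀ x ∈ Q, ∀ y ∈ Q, ∀ z, x < y → y < z → z ∉ Q → w (z - x) = w (z - y)

/-- The word `w` disagrees at `y` with the periodic continuation of its first `c` letters. -/
def IsWrong {A : Type*} (w : ℕ → A) (c y : ℕ) : Prop :=
  1 ≤ y ∧ w y ≠ w ((y - 1) % c + 1)

/-- Copies of `w` started along the run agree outside `Q`. So if the time at offset `y - j * c` from
the end of the run missed `Q`, that position would be wrong too, and induction would put the time
into `Q`. -/
theorem IsCoherent.run_add {A : Type*} {w : ℕ → A} {Q : Set ℕ} (hQ : IsCoherent w Q) {c t : ℕ}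
    (hc : 1 ≤ c) (ht : 1 ≤ t) (hgap : ∀ x ∈ Q, ∀ y ∈ Q, x < y → c ≤ y - x)
    (hmax : ∀ b, ¬ ∀ j ≤ t + 1, b + j * c ∈ Q) {b : ℕ} (hb : ∀ j ≤ t, b + j * c ∈ Q) {y : ℕ}
    (hy : IsWrong w c y) : ∀ j ≤ t, b + y + j * c ∈ Q := by
  have hend : b + t * c ∈ Q := hb t le_rfl
  have hper : ∀ p, 1 ≤ p → b + t * c + p ∉ Q → ∀ j ≤ t, w (p + j * c) = w p := by
    intro p hp hpQ j hj
    rcases Nat.eq_zero_or_pos j with rfl | hj0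
    · simp
    obtain ⟨i, rfl⟩ := Nat.exists_eq_add_of_le hj
    have h := hQ (b + i * c) (hb i (by omega)) _ hend (b + (j + i) * c + p) (by nlinarith)
      (by omega) hpQ
    have e1 : b + (j + i) * c + p - (b + i * c) = p + j * c := by rw [add_mul]; omega
    have e2 : b + (j + i) * c + p - (b + (j + i) * c) = p := by omega
    rwa [e1, e2] at h
  have hnext : ∀ p, 1 ≤ p → p ≤ c → b + t * c + p ∉ Q := by
    intro p hp hpc hpQ
    have h := hgap _ hend _ hpQ (by omega)
    have hpc' : p = c := by omega
    subst hpc'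
    refine hmax b fun j hj => ?_
    rcases Nat.lt_or_ge t j with h1 | h1
    · obtain rfl : j = t + 1 := by omega
      rwa [add_mul, one_mul, ← add_assoc]
    · exact hb j h1
  induction y using Nat.strong_induction_on with
  | _ y ih =>
  obtain ⟨hy1, hyw⟩ := hy
  have hbig : (t + 1) * c < y := by
    by_contra hle
    refine hyw ?_
    have hm := Nat.mod_add_div (y - 1) c
    have hlt := Nat.mod_lt (y - 1) (show 0 < c from hc)
    have hj : (y - 1) / c ≤ t := by
      rw [← Nat.lt_succ_iff, Nat.div_lt_iff_lt_mul hc]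
      simp only [Nat.succ_eq_add_one]
      omega
    have h := hper ((y - 1) % c + 1) (by omega) (hnext _ (by omega) (by omega)) _ hj
    have e : (y - 1) % c + 1 + (y - 1) / c * c = y := by
      rw [mul_comm ((y - 1) / c)]; omega
    rwa [e] at h
  have hwrong_mem : ∀ p < y, IsWrong w c p → b + t * c + p ∈ Q := by
    intro p hp hpw
    have := ih p hp hpw t le_rfl
    rwa [add_right_comm] at this
  have hback : ∀ j, 1 ≤ j → j ≤ t → b + t * c + (y - j * c) ∈ Q := by
    intro j hj1 hj
    by_contra hn
    have hjc : j * c ≤ t * c := Nat.mul_le_mul_right c hj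
    have hjc1 : 1 ≤ j * c := Nat.mul_pos hj1 hc
    rw [add_mul, one_mul] at hbig
    have h := hper (y - j * c) (by omega) hn j hj
    rw [Nat.sub_add_cancel (by omega)] at h
    refine hn (hwrong_mem _ (by omega) ⟨by omega, ?_⟩)
    rw [← h]
    have e : (y - j * c - 1) % c = (y - 1) % c := by
      have : y - 1 = (y - j * c - 1) + j * c := by omega
      rw [this, Nat.add_mul_mod_self_right]
    rwa [e]
  have hyQ : b + t * c + y ∈ Q := by
    by_contra hn
    rw [add_mul, one_mul] at hbig
    have hc_mem : b + t * c + (y - c) ∈ Q := by simpa using hback 1 le_rfl ht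
    have hnot : ∀ i, 1 ≤ i → i ≤ c → b + t * c + (y - c) + i ∉ Q := by
      intro i hi1 hi hmem
      rcases Nat.lt_or_ge i c with h | h
      · have := hgap _ hc_mem _ hmem (by omega)
        omega
      · apply hn
        have e : b + t * c + y = b + t * c + (y - c) + i := by omega
        rwa [e]
    have hcopy : ∀ i, 1 ≤ i → i ≤ c → w (y - c + i) = w i := by
      intro i hi1 hi
      have h := hQ _ hend _ hc_mem _ (by omega) (by omega) (hnot i hi1 hi)
      have e1 : b + t * c + (y - c) + i - (b + t * c) = y - c + i := by omega
      have e2 : b + t * c + (y - c) + i - (b + t * c + (y - c)) = i := by omega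
      rwa [e1, e2] at h
    -- The block of `c` letters ending at `y` copies the first block, while its first `c - 1`
    -- letters follow the periodic continuation, since wrong ones would lie in `Q`. So a rotation of
    -- the first block agrees with it in all places but one, hence everywhere, and `y` is not wrong.
    obtain ⟨e, rfl⟩ : ∃ e, c = e + 1 := ⟨c - 1, by omega⟩
    have h := apply_add_mod_last_eq (fun i => w (i + 1)) e (y - (e + 1)) (by
      intro i hi
      have h1 : ¬ IsWrong w (e + 1) (y - (e + 1) + (i + 1)) := fun h2 =>
        hnot (i + 1) (by omega) (by omega) (by
          have := hwrong_mem _ (by omega) h2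
          rwa [← add_assoc] at this)
      simp only [IsWrong, not_and, not_not] at h1
      have h3 := h1 (by omega)
      rw [hcopy (i + 1) (by omega) (by omega)] at h3
      rw [h3, show y - (e + 1) + (i + 1) - 1 = y - (e + 1) + i by omega])
    have h4 := hcopy (e + 1) (by omega) le_rfl
    rw [Nat.sub_add_cancel (by omega)] at h4
    apply hyw
    rw [h4]
    beta_reduce at h
    rw [show y - (e + 1) + e = y - 1 by omega] at h
    exact h.symm
  intro j hj
  rcases Nat.eq_or_lt_of_le hj with rfl | hlt
  · rwa [add_right_comm]
  · have h := hback (t - j) (by omega) (by omega)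
    have e : b + t * c + (y - (t - j) * c) = b + y + j * c := by
      obtain ⟨i, rfl⟩ := Nat.exists_eq_add_of_le hj
      rw [add_tsub_cancel_left]
      rw [add_mul, one_mul, add_mul] at hbig
      rw [add_mul]
      omega
    rwa [e] at h

/-- Runs can be shifted by every sum of wrong positions. If these had gcd 1, `Q` would contain all
large numbers, so `c = 1` and runs would be too long. With gcd `k > 1`, a position congruent to 1
modulo `k` is never wrong. -/
theorem IsCoherent.exists_constant_progression {A : Type*} {w : ℕ → A} {Q : Set ℕ}
    (hQ : IsCoherent w Q) {c t : ℕ}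
    (hc : 1 ≤ c) (ht : 1 ≤ t) (hgap : ∀ x ∈ Q, ∀ y ∈ Q, x < y → c ≤ y - x)
    (hmax : ∀ b, ¬ ∀ j ≤ t + 1, b + j * c ∈ Q) (h0 : ∀ j ≤ t, j * c ∈ Q) :
    ∃ k m : ℕ, 1 ≤ k ∧ 1 ≤ m ∧ ∀ n, w (m + k * n) = w m := by
  have hright : ∀ n, ¬ IsWrong w c (1 + c * n) → w (1 + c * n) = w 1 := by
    intro n hn
    simp only [IsWrong, not_and, not_not] at hn
    rw [hn (by omega)]
    simp
  by_cases hW : ∃ y, IsWrong w c y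
  swap
  · push Not at hW
    exact ⟨c, 1, hc, le_rfl, fun n => hright n (hW _)⟩
  have hbase : ∀ b ∈ AddSubmonoid.closure {y | IsWrong w c y}, ∀ b', (∀ j ≤ t, b' + j * c ∈ Q) →
      ∀ j ≤ t, b' + b + j * c ∈ Q := by
    intro b hb
    induction hb using AddSubmonoid.closure_induction with
    | mem y hy => intro b' hb'; exact hQ.run_add hc ht hgap hmax hb' hy
    | zero => intro b' hb'; simpa using hb'
    | add x y _ _ hx hy =>
      intro b' hb'
      have := hy _ (hx b' hb')
      simpa only [add_assoc] using this
  obtain ⟨M, hM⟩ := Nat.exists_mem_closure_of_ge {y | IsWrong w c y}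
  set k := Nat.setGcd {y | IsWrong w c y} with hk
  have hk0 : k ≠ 0 := by
    rw [hk, Ne, Nat.setGcd_eq_zero_iff]
    obtain ⟨y, hy⟩ := hW
    intro h
    have h1 : y = 0 := h hy
    have h2 := hy.1
    omega
  have hk1 : k ≠ 1 := by
    intro h1
    have hm : ∀ m ≥ M, m + t * c ∈ Q := by
      intro m hm
      have := hbase m (hM m hm (by rw [h1]; exact one_dvd _)) 0 (by simpa using h0) t le_rfl
      simpa using this
    have h2 := hgap _ (hm M le_rfl) _ (hm (M + 1) (by omega)) (by omega)
    obtain rfl : c = 1 := by omega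
    refine hmax (M + t) fun j _ => ?_
    have := hm (M + j) (by omega)
    convert this using 1
    ring
  refine ⟨c * k, 1, Nat.mul_pos hc (by omega), le_rfl, fun n => ?_⟩
  rw [mul_assoc]
  refine hright _ fun h => hk1 ?_
  have h1 := Nat.setGcd_dvd_of_mem (show 1 + c * (k * n) ∈ {y | IsWrong w c y} from h)
  rw [← hk] at h1
  have h2 : k ∣ c * (k * n) := Dvd.dvd.mul_left (dvd_mul_right k n) c
  exact Nat.dvd_one.1 ((Nat.dvd_add_left h2).1 h1)

/-- `P m l` stands for a return from level `m` to level `l`. The three rules are all the geometry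
that enters. -/
theorem exists_constant_progression_of_frequently {A : Type*} (w : ℕ → A) (P : ℕ → ℕ → Prop)
    (htrans : ∀ m l k, P m l → k < l → (P m k ↔ P l k))
    (hlt : ∀ m l, P m l → l < m)
    (hmis : ∀ m l p, P m l → 1 ≤ p → p ≤ l + 1 → w (p + (m - l)) ≠ w p → p ≤ l ∧ P l (l - p))
    {d : ℕ} (hd : ∃ᶠ n in Filter.atTop, P (n + d) n) :
    ∃ k m : ℕ, 1 ≤ k ∧ 1 ≤ m ∧ ∀ n, w (m + k * n) = w m := by
  classical
  have hex : ∃ c, ∃ᶠ n in Filter.atTop, P (n + c) n := ⟨d, hd⟩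
  obtain ⟨c, hcf, hcmin⟩ : ∃ c, (∃ᶠ n in Filter.atTop, P (n + c) n) ∧
      ∀ e < c, ¬ ∃ᶠ n in Filter.atTop, P (n + e) n :=
    ⟨Nat.find hex, Nat.find_spec hex, fun e he => Nat.find_min hex he⟩
  have hc : 1 ≤ c := by
    obtain ⟨n, hn⟩ := hcf.exists
    have := hlt _ _ hn
    omega
  obtain ⟨M, hM⟩ : ∃ M, ∀ n ≥ M, ∀ e < c, ¬ P (n + e) n := by
    rw [← Filter.eventually_atTop]
    have : ∀ᶠ n in Filter.atTop, ∀ e ∈ Finset.range c, ¬ P (n + e) n := by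
      rw [Filter.eventually_all_finset]
      intro e he
      exact Filter.not_frequently.1 (hcmin e (Finset.mem_range.1 he))
    filter_upwards [this] with n hn e he using hn e (Finset.mem_range.2 he)
  let Run : ℕ → ℕ → Prop := fun t n => ∀ i < t, P (n + (i + 1) * c) (n + i * c)
  have hP : ∀ m l k, P m l → P l k → P m k := fun m l k h1 h2 =>
    (htrans m l k h1 (hlt _ _ h2)).2 h2
  have hrun : ∀ t n, Run t n → ∀ i j, i < j → j ≤ t → P (n + j * c) (n + i * c) := by
    intro t n hr i j hij
    induction j, hij using Nat.le_induction with
    | base => intro hj; exact hr i (by omega)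
    | succ j _ ih => intro hj; exact hP _ _ _ (hr j (by omega)) (ih (by omega))
  by_cases hA : ∀ t, ∃ᶠ n in Filter.atTop, Run t n
  · have hgood : ∀ t, ∃ p < M + c + 2, 1 ≤ p ∧ ∀ j ≤ t, w (p + j * c) = w p := by
      intro t
      have hex : ∃ n, M ≤ n ∧ Run (t + 1) n := by
        obtain ⟨n, hn, hMn⟩ := ((hA (t + 1)).and_eventually (Filter.eventually_ge_atTop M)).exists
        exact ⟨n, hMn, hn⟩
      obtain ⟨n, ⟨hMn, hn⟩, hmin⟩ : ∃ n, (M ≤ n ∧ Run (t + 1) n) ∧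
          ∀ n' < n, ¬ (M ≤ n' ∧ Run (t + 1) n') :=
        ⟨Nat.find hex, Nat.find_spec hex, fun e he => Nat.find_min hex he⟩
      have hw : ∀ p, 1 ≤ p → p ≤ n + 1 → ¬ (p ≤ n ∧ P n (n - p)) →
          ∀ j ≤ t, w (p + j * c) = w p := by
        intro p hp1 hp hnp j hj
        rcases Nat.eq_zero_or_pos j with rfl | hj0
        · simp
        by_contra hne
        have h1 := hrun _ _ hn 0 j hj0 (by omega)
        simp only [zero_mul, add_zero] at h1
        exact hnp (hmis _ _ p h1 hp1 hp (by simpa using hne))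
      -- Position `n + 1` cannot mismatch by `hmis`, and it is bounded if `n < M + c`. For larger
      -- `n` position 1 serves: a mismatch there is a return of gap 1, excluded by the choice of `c`
      -- if `c > 1` and by the minimality of `n` if `c = 1`.
      rcases Nat.lt_or_ge n (M + c) with h | h
      · exact ⟨n + 1, by omega, by omega, hw _ (by omega) le_rfl (by omega)⟩
      · refine ⟨1, by omega, le_rfl, hw 1 le_rfl (by omega) ?_⟩
        rintro ⟨-, h1⟩
        rcases Nat.lt_or_ge 1 c with h2 | h2
        · refine hM (n - 1) (by omega) 1 h2 ?_
          rwa [Nat.sub_add_cancel (by omega)]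
        · obtain rfl : c = 1 := by omega
          refine hmin (n - 1) (by omega) ⟨by omega, fun i hi => ?_⟩
          rcases Nat.eq_zero_or_pos i with rfl | hi0
          · simpa [Nat.sub_add_cancel (show 1 ≤ n by omega)] using h1
          · have := hn (i - 1) (by omega)
            convert this using 1 <;> omega
    by_contra hcon
    have hbad : ∀ p, ∃ t, 1 ≤ p → ∃ j ≤ t, w (p + j * c) ≠ w p := by
      intro p
      by_contra hp
      push Not at hp
      refine hcon ⟨c, p, hc, (hp 0).1, fun n => ?_⟩
      rw [mul_comm]
      exact (hp n).2 n le_rfl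
    choose T hT using hbad
    -- Pigeonhole over the finitely many candidate positions: the sum dominates each failure
    -- threshold `T p`.
    obtain ⟨p, hp, hp1, hpw⟩ := hgood (∑ p ∈ Finset.range (M + c + 2), T p)
    obtain ⟨j, hj, hjw⟩ := hT p hp1
    exact hjw (hpw j (hj.trans (Finset.single_le_sum (f := T) (fun _ _ => Nat.zero_le _)
      (Finset.mem_range.2 hp))))
  · rw [not_forall] at hA
    obtain ⟨t, ht, htmin⟩ : ∃ t, (∃ᶠ n in Filter.atTop, Run t n) ∧
        ¬ ∃ᶠ n in Filter.atTop, Run (t + 1) n := by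
      by_contra hcon
      simp only [not_exists, not_and, not_not] at hcon
      obtain ⟨t, ht⟩ := hA
      refine ht ?_
      induction t with
      | zero =>
        exact Filter.Frequently.of_forall fun n i hi => absurd hi (by omega)
      | succ t ih =>
        by_contra h
        by_cases h2 : ∃ᶠ n in Filter.atTop, Run t n
        · exact h (hcon t h2)
        · exact h2 (ih h2)
    have ht1 : 1 ≤ t := by
      by_contra h
      obtain rfl : t = 0 := by omega
      refine htmin (hcf.mono fun n hn i hi => ?_)
      obtain rfl : i = 0 := by omega
      simpa using hn
    have : (Filter.atTop ⊓ Filter.principal {n | Run t n}).NeBot :=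
      Filter.frequently_mem_iff_neBot.1 ht
    -- Limit along the levels that carry a run of maximal length. `Q` records how far below the top
    -- `n + t * c` of the run the returns from it end.
    let U : Ultrafilter ℕ := Ultrafilter.of (Filter.atTop ⊓ Filter.principal {n | Run t n})
    have hU : (U : Filter ℕ) ≤ Filter.atTop ⊓ Filter.principal {n | Run t n} := Ultrafilter.of_le _
    have hUtop : ∀ m, ∀ᶠ n in (U : Filter ℕ), m ≤ n := fun m =>
      (hU.trans inf_le_left) (Filter.eventually_ge_atTop m)
    have hUrun : ∀ᶠ n in (U : Filter ℕ), Run t n :=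
      (hU.trans inf_le_right) (Filter.mem_principal_self _)
    let Q : Set ℕ := {x | x = 0 ∨ ∀ᶠ n in (U : Filter ℕ), P (n + t * c) (n + t * c - x)}
    have hQP : ∀ x ∈ Q, ∀ y ∈ Q, x < y →
        ∀ᶠ n in (U : Filter ℕ), P (n + t * c - x) (n + t * c - y) := by
      rintro x (rfl | hx) y (rfl | hy) hxy
      · exact absurd hxy (by omega)
      · simpa using hy
      · exact absurd hxy (by omega)
      · filter_upwards [hx, hy, hUtop y] with n h1 h2 h3
        exact (htrans _ _ _ h1 (by omega)).1 h2
    -- A mismatch at time `z` yields a return from depth `y` to depth `z`; composed with the return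
    -- to depth `y`, it puts `z` into `Q`.
    have hcoh : IsCoherent w Q := by
      intro x hx y hy z hxy hyz hz
      by_contra hne
      refine hz (Or.inr ?_)
      rcases hy with rfl | hy'
      · omega
      filter_upwards [hQP x hx y (Or.inr hy') hxy, hy', hUtop z] with n h1 h2 h3
      have h4 := (hmis _ _ (z - y) h1 (by omega) (by omega) (by
        rwa [show z - y + (n + t * c - x - (n + t * c - y)) = z - x by omega])).2
      rw [show n + t * c - y - (z - y) = n + t * c - z by omega] at h4
      exact hP _ _ _ h2 h4
    refine hcoh.exists_constant_progression hc ht1 ?_ ?_ ?_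
    · intro x hx y hy hxy
      by_contra hlt'
      obtain ⟨n, h1, h2⟩ := ((hQP x hx y hy hxy).and (hUtop (M + y))).exists
      refine hM (n + t * c - y) (by omega) (y - x) (by omega) ?_
      rwa [show n + t * c - y + (y - x) = n + t * c - x by omega]
    · intro b hb
      refine htmin ?_
      have h1 : ∀ᶠ n in (U : Filter ℕ), ∀ j ∈ Finset.range (t + 1),
          P (n + t * c - (b + j * c)) (n + t * c - (b + (j + 1) * c)) := by
        rw [Filter.eventually_all_finset]
        intro j hj
        have hj' := Finset.mem_range.1 hj
        exact hQP _ (hb j (by omega)) _ (hb (j + 1) (by omega)) (by nlinarith)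
      rw [Filter.frequently_atTop]
      intro m
      obtain ⟨n, h2, h3⟩ := (h1.and (hUtop (m + b + (t + 1) * c))).exists
      refine ⟨n + t * c - (b + (t + 1) * c), by omega, fun i hi => ?_⟩
      have h4 := h2 (t - i) (Finset.mem_range.2 (by omega))
      obtain ⟨s, rfl⟩ : ∃ s, t = i + s := ⟨t - i, by omega⟩
      rw [add_tsub_cancel_left] at h4
      convert h4 using 1
      · have e : (i + s + 1) * c = (i + 1) * c + s * c := by ring
        rw [e] at h3 ⊢
        omega
      · have e : (i + s + 1) * c = i * c + (s + 1) * c := by ring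
        rw [e] at h3 ⊢
        omega
    · intro j hj
      rcases Nat.eq_zero_or_pos j with rfl | hj0
      · exact Or.inl (zero_mul c)
      refine Or.inr ?_
      filter_upwards [hUrun] with n hn
      have h1 := hrun t n hn (t - j) t (by omega) le_rfl
      obtain ⟨s, rfl⟩ : ∃ s, t = j + s := ⟨t - j, by omega⟩
      rw [add_tsub_cancel_left] at h1
      rwa [show n + (j + s) * c - j * c = n + s * c by rw [add_mul]; omega]

/-! ### Sides of geodesics -/

/-- The function whose zero set in the closed unit disc is the geodesic joining `a` and `b`; its
sign tells the two sides of the geodesic apart. -/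
noncomputable def side (a b : Circle) (z : ℂ) : ℝ :=
  (1 + ‖z‖ ^ 2) / 2 * ((b : ℂ) * star (a : ℂ)).im + (z * star ((b : ℂ) - a)).im

theorem coe_exp_re (t : ℝ) : (Circle.exp t : ℂ).re = Real.cos t := by
  rw [Circle.coe_exp, Complex.exp_ofReal_mul_I_re]

theorem coe_exp_im (t : ℝ) : (Circle.exp t : ℂ).im = Real.sin t := by
  rw [Circle.coe_exp, Complex.exp_ofReal_mul_I_im]

/-- On the circle the function is twice the signed area of the triangle. The product form lets its
sign be read off the cyclic order. -/
theorem side_exp (A B X : ℝ) : side (Circle.exp A) (Circle.exp B) (Circle.exp X) =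
    -4 * Real.sin ((B - A) / 2) * Real.sin ((X - B) / 2) * Real.sin ((A - X) / 2) := by
  have h : side (Circle.exp A) (Circle.exp B) (Circle.exp X) =
      Real.sin (B - A) + Real.sin (X - B) + Real.sin (A - X) := by
    simp only [side, Circle.norm_coe, Complex.star_def, Complex.mul_im, Complex.conj_re,
      Complex.conj_im, Complex.sub_re, Complex.sub_im, coe_exp_re, coe_exp_im, Real.sin_sub]
    ring
  have hA : A = 2 * (A / 2) := by ring
  have hB : B = 2 * (B / 2) := by ring
  have hX : X = 2 * (X / 2) := by ring
  rw [h]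
  have e1 : X - B = 2 * ((X - B) / 2) := by ring
  have e2 : A - X = 2 * ((A - X) / 2) := by ring
  have e3 : B - A = -(2 * ((X - B) / 2) + 2 * ((A - X) / 2)) := by ring
  have e4 : (B - A) / 2 = -((X - B) / 2 + (A - X) / 2) := by ring
  rw [e4, e3, e1, e2]
  generalize (X - B) / 2 = p
  generalize (A - X) / 2 = q
  have e5 : 2 * p / 2 = p := by ring
  have e6 : 2 * q / 2 = q := by ring
  simp only [e5, e6, Real.sin_neg, Real.sin_add, Real.sin_two_mul, Real.cos_two_mul']
  have h1 := Real.sin_sq_add_cos_sq p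
  have h2 := Real.sin_sq_add_cos_sq q
  linear_combination (-2 * Real.sin q * Real.cos q) * h1 + (-2 * Real.sin p * Real.cos p) * h2

theorem exists_exp_eq (x : Circle) : ∃ t, x = Circle.exp t :=
  ⟨_, (Circle.exp_arg x).symm⟩

theorem sin_half_sub_eq_zero_iff (X B : ℝ) :
    Real.sin ((X - B) / 2) = 0 ↔ Circle.exp X = Circle.exp B := by
  rw [Real.sin_eq_zero_iff, Circle.exp_eq_exp]
  refine exists_congr fun n => ?_
  constructor <;> intro h <;> linarith

theorem side_eq_zero_iff {a b x : Circle} (hab : a ≠ b) :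
    side a b x = 0 ↔ x = a ∨ x = b := by
  obtain ⟨A, rfl⟩ := exists_exp_eq a
  obtain ⟨B, rfl⟩ := exists_exp_eq b
  obtain ⟨X, rfl⟩ := exists_exp_eq x
  have h : Real.sin ((B - A) / 2) ≠ 0 := fun h => hab ((sin_half_sub_eq_zero_iff B A).1 h).symm
  have h4 : (-4 : ℝ) * Real.sin ((B - A) / 2) ≠ 0 := mul_ne_zero (by norm_num) h
  rw [side_exp, mul_eq_zero, mul_eq_zero, or_iff_right h4, sin_half_sub_eq_zero_iff,
    sin_half_sub_eq_zero_iff, eq_comm (a := Circle.exp A)]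
  exact or_comm

theorem side_swap (a b : Circle) (z : ℂ) : side b a z = -side a b z := by
  simp only [side, Complex.star_def, Complex.mul_im, Complex.conj_re,
      Complex.conj_im, Complex.sub_re, Complex.sub_im]
  ring

theorem sign_sin_half {u : ℝ} (h1 : -Real.pi < u) (h2 : u < Real.pi) :
    SignType.sign (Real.sin (u / 2)) = SignType.sign (Real.sin u) := by
  have h : Real.sin u = 2 * Real.sin (u / 2) * Real.cos (u / 2) := by
    rw [← Real.sin_two_mul]; ring_nf
  have hc : 0 < Real.cos (u / 2) := Real.cos_pos_of_mem_Ioo ⟨by linarith, by linarith⟩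
  rw [h, sign_mul, sign_mul, sign_pos hc, sign_pos (two_pos : (0 : ℝ) < 2)]
  simp

theorem exists_angle_of_im_pos {x s : Circle} (h : 0 < ((x / s : Circle) : ℂ).im) :
    ∃ t, 0 < t ∧ t < Real.pi ∧ x = s * Circle.exp t := by
  have he := Circle.exp_arg (x / s)
  have hs : ((x / s : Circle) : ℂ).im = Real.sin (Complex.arg ((x / s : Circle) : ℂ)) := by
    conv_lhs => rw [← he]
    exact coe_exp_im _
  have h1 := Complex.neg_pi_lt_arg ((x / s : Circle) : ℂ)
  have h2 := Complex.arg_le_pi ((x / s : Circle) : ℂ)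
  rw [hs] at h
  refine ⟨_, ?_, lt_of_le_of_ne h2 ?_, by rw [he]; simp⟩
  · by_contra hn
    exact (Real.sin_nonpos_of_nonpos_of_neg_pi_le (not_lt.1 hn) h1.le).not_gt h
  · intro h3
    rw [h3, Real.sin_pi] at h
    exact lt_irrefl _ h

theorem exists_angle_of_im_nonpos {x s : Circle} (h : ((x / s : Circle) : ℂ).im ≤ 0) :
    ∃ t, -Real.pi ≤ t ∧ t ≤ 0 ∧ x = s * Circle.exp t := by
  have he := Circle.exp_arg (x / s)
  have hs : ((x / s : Circle) : ℂ).im = Real.sin (Complex.arg ((x / s : Circle) : ℂ)) := by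
    conv_lhs => rw [← he]
    exact coe_exp_im _
  have h1 := Complex.neg_pi_lt_arg ((x / s : Circle) : ℂ)
  have h2 := Complex.arg_le_pi ((x / s : Circle) : ℂ)
  rw [hs] at h
  rcases h2.eq_or_lt with h3 | h3
  · refine ⟨-Real.pi, le_rfl, by linarith [Real.pi_pos], ?_⟩
    have : Circle.exp (-Real.pi) = Circle.exp Real.pi := by
      rw [Circle.exp_eq_exp]; exact ⟨-1, by push_cast; ring⟩
    rw [this, ← h3, he]; simp
  · refine ⟨_, h1.le, ?_, by rw [he]; simp⟩
    by_contra hn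
    exact h.not_gt (Real.sin_pos_of_pos_of_lt_pi (not_le.1 hn) h3)

theorem exp_sq (t : ℝ) : Circle.exp t ^ 2 = Circle.exp (2 * t) := by
  rw [pow_two, ← Circle.exp_add, two_mul]

/-- Squaring preserves the sides of geodesics with end points in an open half circle, at points of
that half circle. -/
theorem sign_side_sq_of_pos {s a b x : Circle} (ha : 0 < ((a / s : Circle) : ℂ).im)
    (hb : 0 < ((b / s : Circle) : ℂ).im) (hx : 0 < ((x / s : Circle) : ℂ).im) :
    SignType.sign (side a b x) =
      SignType.sign (side (a ^ 2) (b ^ 2) ((x ^ 2 : Circle) : ℂ)) := by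
  obtain ⟨A, hA0, hA, rfl⟩ := exists_angle_of_im_pos ha
  obtain ⟨B, hB0, hB, rfl⟩ := exists_angle_of_im_pos hb
  obtain ⟨X, hX0, hX, rfl⟩ := exists_angle_of_im_pos hx
  obtain ⟨S, rfl⟩ := exists_exp_eq s
  simp only [← Circle.exp_add, exp_sq, side_exp, sign_mul]
  rw [sign_sin_half (u := S + B - (S + A)) (by linarith) (by linarith),
    sign_sin_half (u := S + X - (S + B)) (by linarith) (by linarith),
    sign_sin_half (u := S + A - (S + X)) (by linarith) (by linarith)]
  congr 4 <;> ring_nf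

/-- The whole complementary closed half circle lies on the same side as its end point `s`, so `s ^
2` replaces the square of `x`. -/
theorem sign_side_sq_of_nonpos {s a b x : Circle} (ha : 0 < ((a / s : Circle) : ℂ).im)
    (hb : 0 < ((b / s : Circle) : ℂ).im) (hx : ((x / s : Circle) : ℂ).im ≤ 0) :
    SignType.sign (side a b x) =
      SignType.sign (side (a ^ 2) (b ^ 2) ((s ^ 2 : Circle) : ℂ)) := by
  obtain ⟨A, hA0, hA, rfl⟩ := exists_angle_of_im_pos ha
  obtain ⟨B, hB0, hB, rfl⟩ := exists_angle_of_im_pos hb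
  obtain ⟨X, hX0, hX, rfl⟩ := exists_angle_of_im_nonpos hx
  obtain ⟨S, rfl⟩ := exists_exp_eq s
  simp only [← Circle.exp_add, exp_sq, side_exp, sign_mul]
  have e1 : Real.sin ((2 * S - 2 * (S + B)) / 2) < 0 :=
    Real.sin_neg_of_neg_of_neg_pi_lt (by linarith) (by linarith)
  have e2 : 0 < Real.sin ((2 * (S + A) - 2 * S) / 2) :=
    Real.sin_pos_of_pos_of_lt_pi (by linarith) (by linarith)
  have e3 : Real.sin ((S + X - (S + B)) / 2) < 0 :=
    Real.sin_neg_of_neg_of_neg_pi_lt (by linarith) (by linarith)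
  have e4 : 0 < Real.sin ((S + A - (S + X)) / 2) :=
    Real.sin_pos_of_pos_of_lt_pi (by linarith) (by linarith)
  rw [sign_neg e1, sign_pos e2, sign_neg e3, sign_pos e4,
    sign_sin_half (u := S + B - (S + A)) (by linarith) (by linarith)]
  congr 4
  ring_nf

/-! ### Letters and inverse branches -/

theorem hop_neg (x : Circle) : hop (-x) = hop x := by simp [hop]

theorem hop_eq_hop_iff {x y : Circle} : hop x = hop y ↔ x = y ∨ x = -y := by
  constructor
  · intro h
    have h' : (x : ℂ) ^ 2 = (y : ℂ) ^ 2 := by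
      have := congrArg (fun z : Circle => (z : ℂ)) h
      simpa [hop] using this
    rcases sq_eq_sq_iff_eq_or_eq_neg.1 h' with h1 | h1
    · exact Or.inl (Circle.ext h1)
    · exact Or.inr (Circle.ext (by rw [h1, Circle.coe_neg]))
  · rintro (rfl | rfl)
    · rfl
    · exact hop_neg y

theorem hop_star₁ (α : Circle) : hop (star₁ α) = α := hop_root α

theorem hop_star₂ (α : Circle) : hop (star₂ α) = α := by
  rw [star₂, hop_neg, hop_root]

theorem circle_neg_ne (x : Circle) : -x ≠ x := by
  intro h
  have h1 : -(x : ℂ) = x := by rw [← Circle.coe_neg, h]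
  have h2 : (x : ℂ) = 0 := by linear_combination (-1 / 2 : ℂ) * h1
  exact Circle.coe_ne_zero x h2

theorem star₁_ne_star₂ (α : Circle) : star₁ α ≠ star₂ α := (circle_neg_ne _).symm

theorem letter_eq_none_iff {α x : Circle} : letter α x = none ↔ hop x = α := by
  unfold letter
  split_ifs <;> simp_all

/-- The point from which the open half circle of a letter starts, counterclockwise. -/
noncomputable def startPoint (α : Circle) : Letter → Circle
  | Letter.L => star₁ α
  | Letter.R => star₂ α

theorem startPoint_sq (α : Circle) (l : Letter) : startPoint α l ^ 2 = α := by
  cases l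
  · exact hop_star₁ α
  · exact hop_star₂ α

theorem im_div_star₁_eq_zero_iff {α x : Circle} :
    ((x / star₁ α : Circle) : ℂ).im = 0 ↔ hop x = α := by
  have h : hop x = α ↔ x = star₁ α ∨ x = -star₁ α := by
    rw [← hop_eq_hop_iff, hop_star₁]
  rw [h]
  constructor
  · intro h0
    have h1 : ((x / star₁ α : Circle) : ℂ).re ^ 2 = 1 := by
      have := Circle.normSq_coe (x / star₁ α)
      rw [Complex.normSq_apply, h0] at this
      nlinarith
    rcases (by simpa using h1 : ((x / star₁ α : Circle) : ℂ).re = 1 ∨ ((x / star₁ α : Circle) : ℂ).re = -1) with h2 | h2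
    · left
      exact div_eq_one.1 (Circle.ext (Complex.ext (by simpa using h2) (by simpa using h0)))
    · right
      have : x / star₁ α = -1 :=
        Circle.ext (Complex.ext (by simpa using h2) (by simpa using h0))
      rw [div_eq_iff_eq_mul] at this
      rw [this, neg_one_mul]
  · rintro (rfl | rfl)
    · simp
    · rw [neg_div, div_self']
      simp

theorem letter_eq_some_iff {α x : Circle} {l : Letter} :
    letter α x = some l ↔ 0 < ((x / startPoint α l : Circle) : ℂ).im := by
  have hz := im_div_star₁_eq_zero_iff (α := α) (x := x)
  have hneg : ((x / star₂ α : Circle) : ℂ).im = -((x / star₁ α : Circle) : ℂ).im := by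
    rw [star₂, ← star₁, div_neg, Circle.coe_neg, Complex.neg_im]
  unfold letter
  cases l <;> simp only [startPoint]
  · split_ifs with h1 h2
    · simp only [hz.2 h1, lt_irrefl]
    · simpa using h2
    · simpa using h2
  · rw [hneg]
    split_ifs with h1 h2
    · simp only [hz.2 h1, neg_zero, lt_irrefl]
    · simpa using h2.le
    · have : ((x / star₁ α : Circle) : ℂ).im ≠ 0 := fun h => h1 (hz.1 h)
      simpa using lt_of_le_of_ne (not_lt.1 h2) this

theorem letter_neg_of_letter_ne {α x : Circle} {l : Letter} (hx : hop x ≠ α)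
    (h : letter α x ≠ some l) : letter α (-x) = some l := by
  rw [Ne, letter_eq_some_iff, not_lt] at h
  rw [letter_eq_some_iff, neg_div, Circle.coe_neg, Complex.neg_im, neg_pos]
  refine lt_of_le_of_ne h fun h0 => hx ?_
  rw [← im_div_star₁_eq_zero_iff]
  cases l
  · exact h0
  · rw [startPoint, star₂, div_neg, Circle.coe_neg, Complex.neg_im, neg_eq_zero] at h0
    exact h0

theorem letter_neg_ne {α x : Circle} {l : Letter} (h : letter α x = some l) :
    letter α (-x) ≠ some l := by
  rw [letter_eq_some_iff] at h
  rw [Ne, letter_eq_some_iff, neg_div, Circle.coe_neg, Complex.neg_im, neg_pos, not_lt]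
  exact h.le

theorem hop_branch (α : Circle) (l : Letter) (y : Circle) : hop (branch α l y) = y := by
  unfold branch
  split_ifs
  · exact hop_root y
  · rw [hop_neg, hop_root]

theorem letter_branch {α y : Circle} (hy : y ≠ α) (l : Letter) :
    letter α (branch α l y) = some l := by
  unfold branch
  split_ifs with h
  · exact h
  · exact letter_neg_of_letter_ne (by rwa [hop_root]) h

theorem branch_hop {α x : Circle} {l : Letter} (h : letter α x = some l) :
    branch α l (hop x) = x := by
  rcases hop_eq_hop_iff.1 (hop_root (hop x)) with h1 | h1
  · rw [branch, h1, if_pos h]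
  · rw [branch, h1, if_neg (letter_neg_ne h), neg_neg]

theorem wordMap_cons (α : Circle) (l : Letter) (u : List Letter) (x : Circle) :
    wordMap α (l :: u) x = branch α l (wordMap α u x) := rfl

theorem hop_iterate_wordMap (α : Circle) (u : List Letter) (x : Circle) :
    hop^[u.length] (wordMap α u x) = x := by
  induction u with
  | nil => rfl
  | cons l u ih => rw [wordMap_cons, List.length_cons, Function.iterate_succ_apply, hop_branch, ih]

theorem hop_iterate_wordMap_star₁ (α : Circle) (u : List Letter) :
    hop^[u.length + 1] (wordMap α u (star₁ α)) = α := by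
  rw [Function.iterate_succ_apply', hop_iterate_wordMap, hop_star₁]

theorem hop_iterate_wordMap_star₂ (α : Circle) (u : List Letter) :
    hop^[u.length + 1] (wordMap α u (star₂ α)) = α := by
  rw [Function.iterate_succ_apply', hop_iterate_wordMap, hop_star₂]

theorem wordMap_star₁_ne (α : Circle) (u : List Letter) :
    wordMap α u (star₁ α) ≠ wordMap α u (star₂ α) := fun h =>
  star₁_ne_star₂ α (by rw [← hop_iterate_wordMap α u (star₁ α), h, hop_iterate_wordMap])

/-- The point `α` is not periodic. -/
def Aperiodic (α : Circle) : Prop := ∀ k, hop^[k + 1] α ≠ α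

theorem Aperiodic.ne_of_iterate {α : Circle} (hα : Aperiodic α) {n : ℕ} {x : Circle}
    (hx : hop^[n + 1] x = α) : x ≠ α := by
  rintro rfl
  exact hα n hx

/-- The side of the geodesic of the word `u` on which the point `z` lies. -/
noncomputable def wordSign (α : Circle) (u : List Letter) (z : ℂ) : SignType :=
  SignType.sign (side (wordMap α u (star₁ α)) (wordMap α u (star₂ α)) z)

theorem wordSign_eq_zero_iff {α : Circle} {u : List Letter} {x : Circle} :
    wordSign α u x = 0 ↔ x = wordMap α u (star₁ α) ∨ x = wordMap α u (star₂ α) := by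
  rw [wordSign, sign_eq_zero_iff, side_eq_zero_iff (wordMap_star₁_ne α u)]

theorem wordSign_ne_zero {α : Circle} {u : List Letter} {x : Circle}
    (h : hop^[u.length + 1] x ≠ α) : wordSign α u x ≠ 0 := by
  rw [Ne, wordSign_eq_zero_iff]
  rintro (rfl | rfl)
  · exact h (hop_iterate_wordMap_star₁ α u)
  · exact h (hop_iterate_wordMap_star₂ α u)

-- Squaring carries the geodesic of `l :: u` to that of `u` as far as sides at points of the half
-- circle `l` are concerned. All other points lie on the side of `⋆₁` and `⋆₂`, which map to `α`.
-- Aperiodicity keeps the end points for `u` away from `α`, where the branches are irregular.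
open Classical in
theorem wordSign_cons {α : Circle} (hα : Aperiodic α) (l : Letter) (u : List Letter) (x : Circle) :
    wordSign α (l :: u) x = wordSign α u ((if letter α x = some l then hop x else α : Circle)) := by
  have ha := hα.ne_of_iterate (hop_iterate_wordMap_star₁ α u)
  have hb := hα.ne_of_iterate (hop_iterate_wordMap_star₂ α u)
  have ha' := letter_eq_some_iff.1 (letter_branch ha l)
  have hb' := letter_eq_some_iff.1 (letter_branch hb l)
  rw [wordSign, wordSign, wordMap_cons, wordMap_cons]
  split_ifs with h
  · rw [sign_side_sq_of_pos ha' hb' (letter_eq_some_iff.1 h)]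
    change SignType.sign (side (hop _) (hop _) (hop x)) = _
    rw [hop_branch, hop_branch]
  · rw [letter_eq_some_iff, not_lt] at h
    rw [sign_side_sq_of_nonpos ha' hb' h, startPoint_sq]
    change SignType.sign (side (hop _) (hop _) _) = _
    rw [hop_branch, hop_branch]

theorem wordSign_nil (α x : Circle) :
    wordSign α [] x = -SignType.sign ((x / star₁ α : Circle) : ℂ).im := by
  have h : side (star₁ α) (star₂ α) x = -(2 * ((x / star₁ α : Circle) : ℂ).im) := by
    rw [star₂, ← star₁, Circle.coe_div, ← mul_one (x : ℂ), mul_div_assoc, one_div,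
      ← Circle.coe_inv, Circle.coe_inv_eq_conj]
    simp only [side, Complex.star_def, Complex.mul_im, Complex.conj_re,
      Complex.conj_im, Complex.sub_re, Complex.sub_im, Circle.coe_neg, Complex.neg_re,
      Complex.neg_im]
    simp
    ring
  change SignType.sign (side (star₁ α) (star₂ α) x) = _
  rw [h, Left.sign_neg, sign_mul, sign_pos (two_pos : (0 : ℝ) < 2), one_mul]

/-! ### Points not separated at a level -/

/-- The points `x` and `y` lie on the same side of every geodesic of level `n`. -/
def SameSide (α : Circle) (n : ℕ) (x y : Circle) : Prop :=
  ∀ u : List Letter, u.length = n → wordSign α u x = wordSign α u y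

theorem SameSide.symm {α : Circle} {n : ℕ} {x y : Circle} (h : SameSide α n x y) :
    SameSide α n y x := fun u hu => (h u hu).symm

theorem SameSide.trans {α : Circle} {n : ℕ} {x y z : Circle} (h : SameSide α n x y)
    (h' : SameSide α n y z) : SameSide α n x z := fun u hu => (h u hu).trans (h' u hu)

theorem SameSide.letter_eq {α x y : Circle} (h : SameSide α 0 x y) :
    letter α x = letter α y := by
  have h1 := h [] rfl
  rw [wordSign_nil, wordSign_nil, neg_inj] at h1
  have e1 : hop x = α ↔ hop y = α := by
    rw [← im_div_star₁_eq_zero_iff, ← im_div_star₁_eq_zero_iff, ← sign_eq_zero_iff, h1,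
      sign_eq_zero_iff]
  have e2 : 0 < ((x / star₁ α : Circle) : ℂ).im ↔ 0 < ((y / star₁ α : Circle) : ℂ).im := by
    rw [← sign_eq_one_iff, h1, sign_eq_one_iff]
  unfold letter
  by_cases h3 : hop y = α
  · rw [if_pos h3, if_pos (e1.2 h3)]
  · rw [if_neg h3, if_neg (mt e1.1 h3)]
    simp only [e2]

/-- The geodesics in the half circle of `x` see `y` as they would see a preimage of `α`. This is how
a disagreement of letters produces a return. -/
theorem SameSide.hop_alpha {α : Circle} (hα : Aperiodic α) {n : ℕ} {x y : Circle}
    (h : SameSide α (n + 1) x y) (hl : letter α x ≠ letter α y) : SameSide α n (hop x) α := by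
  classical
  intro u hu
  rcases hx : letter α x with _ | l
  · rw [letter_eq_none_iff.1 hx]
  · have h1 := h (l :: u) (by simp [hu])
    rw [wordSign_cons hα, wordSign_cons hα, if_pos hx, if_neg] at h1
    · exact h1
    · rw [← hx]; exact hl.symm

theorem SameSide.hop {α : Circle} (hα : Aperiodic α) {n : ℕ} {x y : Circle}
    (h : SameSide α (n + 1) x y) : SameSide α n (hop x) (hop y) := by
  classical
  by_cases hl : letter α x = letter α y
  · rcases hx : letter α x with _ | l
    · rw [letter_eq_none_iff.1 hx, letter_eq_none_iff.1 (hl ▸ hx)]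
      exact fun _ _ => rfl
    · intro u hu
      have h1 := h (l :: u) (by simp [hu])
      rwa [wordSign_cons hα, wordSign_cons hα, if_pos hx, if_pos (hl ▸ hx)] at h1
  · exact (h.hop_alpha hα hl).trans (h.symm.hop_alpha hα (Ne.symm hl)).symm

/-- The alternatives in `hl` mirror those in `pullback`, so that pulling back gains a level. -/
theorem SameSide.of_hop {α : Circle} (hα : Aperiodic α) {n : ℕ} {x y : Circle}
    (h : SameSide α n (QuadLam.hop x) (QuadLam.hop y))
    (hl : letter α x = letter α y ∨ SameSide α n (QuadLam.hop x) α) :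
    SameSide α (n + 1) x y := by
  classical
  rintro (_ | ⟨l, u⟩) hu
  · simp at hu
  have hu' : u.length = n := by simpa using hu
  rw [wordSign_cons hα, wordSign_cons hα]
  rcases hl with hl | hl
  · rw [hl]
    split_ifs
    · exact h u hu'
    · rfl
  · split_ifs
    · exact h u hu'
    · exact hl u hu'
    · exact ((h.symm.trans hl).symm u hu')
    · rfl

theorem SameSide.iterate {α : Circle} (hα : Aperiodic α) {n k : ℕ} {x y : Circle}
    (h : SameSide α (n + k) x y) : SameSide α n (QuadLam.hop^[k] x) (QuadLam.hop^[k] y) := by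
  induction k generalizing x y with
  | zero => exact h
  | succ k ih =>
    rw [Function.iterate_succ_apply, Function.iterate_succ_apply]
    exact ih (SameSide.hop hα h)

/-! ### End points of the geodesics -/

theorem exists_wordMap_eq {α : Circle} (hα : Aperiodic α) {n : ℕ} {x : Circle}
    (hx : hop^[n + 1] x = α) : ∃ u : List Letter, u.length = n ∧
      (x = wordMap α u (star₁ α) ∨ x = wordMap α u (star₂ α)) := by
  induction n generalizing x with
  | zero =>
    refine ⟨[], rfl, ?_⟩
    have h : hop x = hop (star₁ α) := by rw [hop_star₁]; exact hx
    exact hop_eq_hop_iff.1 h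
  | succ n ih =>
    rw [Function.iterate_succ_apply] at hx
    obtain ⟨u, hu, h⟩ := ih hx
    rcases hl : letter α x with _ | l
    · exact absurd (letter_eq_none_iff.1 hl) (hα.ne_of_iterate hx)
    · refine ⟨l :: u, by simp [hu], ?_⟩
      rw [wordMap_cons, wordMap_cons]
      rcases h with h | h
      · left; rw [← h, branch_hop hl]
      · right; rw [← h, branch_hop hl]

/-- Geodesics of one level do not cross: at the first letter where the words differ, both end points
are seen from the complementary half circle, thus as `α`, which is not an end point. -/
theorem wordSign_endpoints {α : Circle} (hα : Aperiodic α) {u v : List Letter}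
    (hlen : u.length = v.length) (huv : u ≠ v) :
    wordSign α v (wordMap α u (star₁ α)) = wordSign α v (wordMap α u (star₂ α)) ∧
      wordSign α v (wordMap α u (star₁ α)) ≠ 0 := by
  classical
  induction u generalizing v with
  | nil =>
    exact absurd (List.eq_nil_of_length_eq_zero hlen.symm).symm huv
  | cons l u ih =>
    rcases v with _ | ⟨m, v⟩
    · simp at hlen
    have ha := letter_branch (hα.ne_of_iterate (hop_iterate_wordMap_star₁ α u)) l
    have hb := letter_branch (hα.ne_of_iterate (hop_iterate_wordMap_star₂ α u)) l
    rw [wordMap_cons, wordMap_cons, wordSign_cons hα, wordSign_cons hα, ha, hb, hop_branch,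
      hop_branch]
    by_cases hlm : l = m
    · subst hlm
      simp only [if_true]
      exact ih (by simpa using hlen) (fun h => huv (by rw [h]))
    · rw [if_neg (by simpa using hlm), if_neg (by simpa using hlm)]
      exact ⟨rfl, wordSign_ne_zero (hα _)⟩

theorem letter_iterate_endpoints {α : Circle} (hα : Aperiodic α) (u : List Letter) (k : ℕ) :
    letter α (hop^[k] (wordMap α u (star₁ α))) = letter α (hop^[k] (wordMap α u (star₂ α))) := by
  induction u generalizing k with
  | nil =>
    change letter α (hop^[k] (star₁ α)) = letter α (hop^[k] (star₂ α))
    cases k with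
    | zero =>
      rw [Function.iterate_zero_apply, Function.iterate_zero_apply,
        letter_eq_none_iff.2 (hop_star₁ α), letter_eq_none_iff.2 (hop_star₂ α)]
    | succ k =>
      rw [Function.iterate_succ_apply, Function.iterate_succ_apply, hop_star₁, hop_star₂]
  | cons l u ih =>
    rw [wordMap_cons, wordMap_cons]
    cases k with
    | zero =>
      rw [Function.iterate_zero_apply, Function.iterate_zero_apply,
        letter_branch (hα.ne_of_iterate (hop_iterate_wordMap_star₁ α u)),
        letter_branch (hα.ne_of_iterate (hop_iterate_wordMap_star₂ α u))]
    | succ k =>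
      rw [Function.iterate_succ_apply, Function.iterate_succ_apply, hop_branch, hop_branch, ih]

theorem aperiodic_of_not_weaklyPreperiodic {α : Circle} (h : ¬ WeaklyPreperiodic α) :
    Aperiodic α := by
  intro k hk
  refine h ⟨k + 1, 1, by omega, le_rfl, itin α α 1, fun n => ?_⟩
  simp only [itin, add_tsub_cancel_left]
  rw [Function.iterate_mul, Function.iterate_fixed hk]
  rfl

/-- A point of the orbit of `α` that is not separated from `α` at infinitely many levels makes `α`
weakly pre-periodic; no condition on the recurrence of `α` is needed. -/
theorem eventually_not_sameSide {α : Circle} (h : ¬ WeaklyPreperiodic α) {i : ℕ} (hi : 1 ≤ i) :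
    ∀ᶠ n in Filter.atTop, ¬ SameSide α n (hop^[i] α) α := by
  have hα := aperiodic_of_not_weaklyPreperiodic h
  by_contra hcon
  refine h ?_
  -- Each application of `hop` costs one level, so a return from level `m` to level `l` takes `m -
  -- l` steps.
  let P : ℕ → ℕ → Prop := fun m l => l < m ∧ SameSide α l (hop^[m - l] α) α
  have hshift : ∀ m l k, P m l → k < l →
      SameSide α k (hop^[m - k] α) (hop^[l - k] α) := by
    rintro m l k ⟨hlm, hs⟩ hkl
    have h1 : SameSide α (k + (l - k)) (hop^[m - l] α) α := by
      rwa [Nat.add_sub_cancel' hkl.le]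
    have h2 := h1.iterate hα
    rwa [← Function.iterate_add_apply, show l - k + (m - l) = m - k by omega] at h2
  obtain ⟨k, m, hk, hm, hw⟩ := exists_constant_progression_of_frequently (itin α α) P
    (fun m l k hP hkl => by
      have hs := hshift m l k hP hkl
      exact ⟨fun h => ⟨hkl, hs.symm.trans h.2⟩, fun h => ⟨hkl.trans hP.1, hs.trans h.2⟩⟩)
    (fun m l hP => hP.1)
    (fun m l p hP hp1 hp hne => by
      have h1 : SameSide α (l + 1 - p + (p - 1)) (hop^[m - l] α) α := by
        rw [show l + 1 - p + (p - 1) = l by omega]; exact hP.2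
      have h2 := h1.iterate hα
      rw [← Function.iterate_add_apply] at h2
      have hne' : letter α (hop^[p - 1 + (m - l)] α) ≠ letter α (hop^[p - 1] α) := by
        simpa only [itin, show p + (m - l) - 1 = p - 1 + (m - l) by omega] using hne
      -- At `p = l + 1` the comparison has come down to level 0, where unseparated points have equal
      -- letters.
      have hpl : p ≤ l := by
        by_contra hpl
        rw [show l + 1 - p = 0 by omega] at h2
        exact hne' h2.letter_eq
      refine ⟨hpl, by omega, ?_⟩
      rw [show l + 1 - p = l - p + 1 by omega] at h2
      have h3 := h2.symm.hop_alpha hα hne'.symm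
      rw [← Function.iterate_succ_apply' hop] at h3
      rwa [show l - (l - p) = p - 1 + 1 by omega])
    (d := i) (by
      rw [Filter.not_eventually] at hcon
      refine hcon.mono fun n hn => ⟨by omega, ?_⟩
      rw [add_tsub_cancel_left]
      exact not_not.1 hn)
  exact ⟨k, m, hk, hm, _, hw⟩

/-! ### Components of the cut disc -/

/-- The homeomorphism of the closed unit disc from the Klein model of the hyperbolic plane to the
Poincaré model. -/
noncomputable def kleinToDisc (w : ℂ) : ℂ := ((1 / (1 + Real.sqrt (1 - ‖w‖ ^ 2)) : ℝ) : ℂ) * w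

theorem continuous_kleinToDisc : Continuous kleinToDisc := by
  unfold kleinToDisc
  refine (Complex.continuous_ofReal.comp (continuous_const.div (by fun_prop) fun w => ?_)).mul
    continuous_id
  positivity

theorem norm_kleinToDisc_le {w : ℂ} (hw : ‖w‖ ≤ 1) : ‖kleinToDisc w‖ ≤ 1 := by
  unfold kleinToDisc
  have h : 0 ≤ Real.sqrt (1 - ‖w‖ ^ 2) := Real.sqrt_nonneg _
  rw [norm_mul, Complex.norm_real, Real.norm_of_nonneg (by positivity), one_div,
    inv_mul_le_iff₀ (by positivity)]
  linarith

theorem kleinToDisc_spec {w : ℂ} (hw : ‖w‖ ≤ 1) :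
    (((1 + ‖kleinToDisc w‖ ^ 2) / 2 : ℝ) : ℂ) * w = kleinToDisc w := by
  have h : 0 ≤ Real.sqrt (1 - ‖w‖ ^ 2) := Real.sqrt_nonneg _
  have hsq : Real.sqrt (1 - ‖w‖ ^ 2) ^ 2 = 1 - ‖w‖ ^ 2 :=
    Real.sq_sqrt (by nlinarith [norm_nonneg w])
  have h1 : (1 + ‖kleinToDisc w‖ ^ 2) / 2 = 1 / (1 + Real.sqrt (1 - ‖w‖ ^ 2)) := by
    unfold kleinToDisc
    rw [norm_mul, Complex.norm_real, Real.norm_of_nonneg (by positivity)]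
    field_simp
    linear_combination hsq
  rw [h1]
  rfl

theorem exists_kleinToDisc_eq {z : ℂ} (hz : ‖z‖ ≤ 1) : ∃ w, ‖w‖ ≤ 1 ∧ kleinToDisc w = z := by
  have hpos : 0 < 1 + ‖z‖ ^ 2 := by positivity
  have hn : ‖((2 / (1 + ‖z‖ ^ 2) : ℝ) : ℂ) * z‖ = 2 * ‖z‖ / (1 + ‖z‖ ^ 2) := by
    rw [norm_mul, Complex.norm_real, Real.norm_of_nonneg (by positivity)]
    ring
  refine ⟨((2 / (1 + ‖z‖ ^ 2) : ℝ) : ℂ) * z, ?_, ?_⟩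
  · rw [hn, div_le_one hpos]
    nlinarith [sq_nonneg (1 - ‖z‖)]
  · have hs : Real.sqrt (1 - (2 * ‖z‖ / (1 + ‖z‖ ^ 2)) ^ 2) = (1 - ‖z‖ ^ 2) / (1 + ‖z‖ ^ 2) := by
      have e : 1 - (2 * ‖z‖ / (1 + ‖z‖ ^ 2)) ^ 2 = ((1 - ‖z‖ ^ 2) / (1 + ‖z‖ ^ 2)) ^ 2 := by
        field_simp
        ring
      rw [e, Real.sqrt_sq (div_nonneg (by nlinarith [norm_nonneg z]) hpos.le)]
    unfold kleinToDisc
    rw [hn, hs, ← mul_assoc, ← Complex.ofReal_mul]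
    have : 1 / (1 + (1 - ‖z‖ ^ 2) / (1 + ‖z‖ ^ 2)) * (2 / (1 + ‖z‖ ^ 2)) = 1 := by
      field_simp
      ring
    rw [this, Complex.ofReal_one, one_mul]

/-- In the Klein model, the sides of a geodesic are half planes. -/
theorem side_kleinToDisc (a b : Circle) {w : ℂ} (hw : ‖w‖ ≤ 1) :
    side a b (kleinToDisc w) = (1 + ‖kleinToDisc w‖ ^ 2) / 2 *
      (((b : ℂ) * star (a : ℂ)).im + (w * star ((b : ℂ) - a)).im) := by
  have h := kleinToDisc_spec hw
  unfold side
  generalize kleinToDisc w = z at *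
  rw [mul_add]
  congr 1
  conv_lhs => rw [← h, mul_assoc, Complex.im_ofReal_mul]

theorem sign_side_kleinToDisc (a b : Circle) {w : ℂ} (hw : ‖w‖ ≤ 1) :
    SignType.sign (side a b (kleinToDisc w)) = SignType.sign
      (((b : ℂ) * star (a : ℂ)).im + (w * star ((b : ℂ) - a)).im) := by
  rw [side_kleinToDisc a b hw, sign_mul, sign_pos (by positivity), one_mul]

theorem convex_setOf_sign_eq (c : ℝ) (d : ℂ) {σ : SignType} (hσ : σ ≠ 0) :
    Convex ℝ {w : ℂ | SignType.sign (c + (w * d).im) = σ} := by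
  have hlin : IsLinearMap ℝ fun w : ℂ => (w * d).im :=
    ⟨fun x y => by simp [add_mul], fun r x => by simp [mul_assoc]⟩
  cases σ
  · exact absurd rfl hσ
  · have h : {w : ℂ | SignType.sign (c + (w * d).im) = SignType.neg} =
        {w : ℂ | (w * d).im < -c} := by
      ext w
      rw [Set.mem_ofPred_eq, Set.mem_ofPred_eq, show (SignType.neg = (-1 : SignType)) from rfl,
        sign_eq_neg_one_iff, lt_neg_iff_add_neg']
    rw [h]
    exact convex_halfSpace_lt hlin (-c)
  · have h : {w : ℂ | SignType.sign (c + (w * d).im) = SignType.pos} =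
        {w : ℂ | -c < (w * d).im} := by
      ext w
      rw [Set.mem_ofPred_eq, Set.mem_ofPred_eq, show (SignType.pos = (1 : SignType)) from rfl,
        sign_eq_one_iff, neg_lt_iff_pos_add']
    rw [h]
    exact convex_halfSpace_gt hlin (-c)

theorem continuous_side (a b : Circle) : Continuous (side a b) := by
  unfold side
  fun_prop

theorem mem_cutDisc_iff {α : Circle} {n : ℕ} {z : ℂ} :
    z ∈ cutDisc α n ↔ ‖z‖ ≤ 1 ∧ ∀ u : List Letter, u.length = n → wordSign α u z ≠ 0 := by
  simp only [cutDisc, Set.mem_sdiff, mem_closedBall_zero_iff, Set.mem_iUnion, Set.mem_ofPred_eq,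
    not_exists, wordSign, Ne, sign_eq_zero_iff]
  refine and_congr_right fun hz => forall₂_congr fun u hu => ?_
  exact not_congr ⟨fun h => h.2, fun h => ⟨hz, h⟩⟩

theorem sign_eq_of_isPreconnected {X : Type*} [TopologicalSpace X] {s : Set X}
    (hs : IsPreconnected s) {f : X → ℝ} (hf : ContinuousOn f s) (h0 : ∀ x ∈ s, f x ≠ 0)
    {x y : X} (hx : x ∈ s) (hy : y ∈ s) : SignType.sign (f x) = SignType.sign (f y) := by
  have key : ∀ x ∈ s, ∀ y ∈ s, f x < 0 → ¬ 0 < f y := by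
    intro x hx y hy h1 h2
    obtain ⟨z, hz, hz0⟩ := hs.intermediate_value hx hy hf ⟨h1.le, h2.le⟩
    exact h0 z hz hz0
  rcases lt_or_gt_of_ne (h0 x hx) with h1 | h1 <;> rcases lt_or_gt_of_ne (h0 y hy) with h2 | h2
  · rw [sign_neg h1, sign_neg h2]
  · exact absurd h2 (key x hx y hy h1)
  · exact absurd h1 (key y hy x hx h2)
  · rw [sign_pos h1, sign_pos h2]

/-- The components of the cut disc are the sets of points with prescribed sides. -/
theorem connectedComponentIn_cutDisc {α : Circle} {n : ℕ} {z : ℂ} (hz : z ∈ cutDisc α n) :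
    connectedComponentIn (cutDisc α n) z =
      {z' | ‖z'‖ ≤ 1 ∧ ∀ u : List Letter, u.length = n → wordSign α u z' = wordSign α u z} := by
  have hz' := mem_cutDisc_iff.1 hz
  apply Set.Subset.antisymm
  · intro z' h
    refine ⟨(mem_cutDisc_iff.1 (connectedComponentIn_subset _ _ h)).1, fun u hu => ?_⟩
    refine sign_eq_of_isPreconnected isPreconnected_connectedComponentIn
      (continuous_side _ _).continuousOn (fun x hx => ?_) h (mem_connectedComponentIn hz)
    have := (mem_cutDisc_iff.1 (connectedComponentIn_subset _ _ hx)).2 u hu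
    rwa [wordSign, Ne, sign_eq_zero_iff] at this
  -- In Klein coordinates the set is the disc intersected with half planes, so it is convex and its
  -- image is connected.
  · have hconv : Convex ℝ (Metric.closedBall (0 : ℂ) 1 ∩
        ⋂ u : {u : List Letter // u.length = n},
          {w : ℂ | SignType.sign
            (((wordMap α u (star₂ α) : ℂ) * star (wordMap α u (star₁ α) : ℂ)).im +
              (w * star ((wordMap α u (star₂ α) : ℂ) - wordMap α u (star₁ α))).im) =
                wordSign α u z}) :=
      (convex_closedBall 0 1).inter
        (convex_iInter fun u => convex_setOf_sign_eq _ _ (hz'.2 u.1 u.2))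
    have himg : {z' : ℂ | ‖z'‖ ≤ 1 ∧
        ∀ u : List Letter, u.length = n → wordSign α u z' = wordSign α u z} = kleinToDisc ''
        (Metric.closedBall (0 : ℂ) 1 ∩
        ⋂ u : {u : List Letter // u.length = n},
          {w : ℂ | SignType.sign
            (((wordMap α u (star₂ α) : ℂ) * star (wordMap α u (star₁ α) : ℂ)).im +
              (w * star ((wordMap α u (star₂ α) : ℂ) - wordMap α u (star₁ α))).im) =
                wordSign α u z}) := by
      ext z'
      simp only [Set.mem_ofPred_eq, Set.mem_image, Set.mem_inter_iff, mem_closedBall_zero_iff,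
        Set.mem_iInter, Subtype.forall]
      constructor
      · rintro ⟨h1, h2⟩
        obtain ⟨w, hw, rfl⟩ := exists_kleinToDisc_eq h1
        exact ⟨w, ⟨hw, fun u hu => by rw [← sign_side_kleinToDisc _ _ hw]; exact h2 u hu⟩, rfl⟩
      · rintro ⟨w, ⟨hw, h⟩, rfl⟩
        refine ⟨norm_kleinToDisc_le hw, fun u hu => ?_⟩
        rw [← h u hu, ← sign_side_kleinToDisc _ _ hw]
        rfl
    rw [himg]
    refine IsPreconnected.subset_connectedComponentIn
      (hconv.isPreconnected.image _ continuous_kleinToDisc.continuousOn) ?_ ?_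
    · rw [← himg]
      exact ⟨hz'.1, fun u _ => rfl⟩
    · rw [← himg]
      rintro z' ⟨h1, h2⟩
      exact mem_cutDisc_iff.2 ⟨h1, fun u hu => by rw [h2 u hu]; exact hz'.2 u hu⟩

/-- The points of the circle that are not end points of geodesics of level `n`. -/
def regularPoints (α : Circle) (n : ℕ) : Set Circle := {x | hop^[n + 1] x ≠ α}

/-- The regular points which lie on the same side as `x` of all geodesics of level `n`. -/
def sideClass (α : Circle) (n : ℕ) (x : Circle) : Set Circle :=
  {y | y ∈ regularPoints α n ∧ SameSide α n y x}

theorem mem_regularPoints_iff {α : Circle} (hα : Aperiodic α) {n : ℕ} {x : Circle} :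
    x ∈ regularPoints α n ↔ ∀ u : List Letter, u.length = n → wordSign α u x ≠ 0 := by
  constructor
  · intro h u hu
    refine wordSign_ne_zero ?_
    rwa [hu]
  · intro h hx
    obtain ⟨u, hu, h1⟩ := exists_wordMap_eq hα hx
    exact h u hu (wordSign_eq_zero_iff.2 h1)

theorem alpha_mem_regularPoints {α : Circle} (hα : Aperiodic α) (n i : ℕ) :
    hop^[i] α ∈ regularPoints α n := by
  intro h
  rw [← Function.iterate_add_apply, add_right_comm] at h
  exact hα _ h

theorem closure_sideClass_mem_GCS {α : Circle} (hα : Aperiodic α) {n : ℕ} {x : Circle}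
    (hx : x ∈ regularPoints α n) : closure (sideClass α n x) ∈ GCS α n := by
  have hx' := (mem_regularPoints_iff hα).1 hx
  have hz : (x : ℂ) ∈ cutDisc α n := mem_cutDisc_iff.2 ⟨(Circle.norm_coe x).le, hx'⟩
  refine ⟨x, hz, ?_⟩
  congr 1
  ext y
  rw [connectedComponentIn_cutDisc hz]
  simp only [sideClass, Set.mem_ofPred_eq, Circle.norm_coe, le_refl, true_and,
    mem_regularPoints_iff hα]
  exact ⟨fun h => h.2, fun h => ⟨fun u hu => by rw [h u hu]; exact hx' u hu, h⟩⟩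

theorem exists_eq_closure_sideClass {α : Circle} (hα : Aperiodic α) {n : ℕ} {C : Set Circle}
    (hC : C ∈ GCS α n) {y : Circle} (hy : y ∈ C) :
    ∃ x ∈ regularPoints α n, C = closure (sideClass α n x) := by
  obtain ⟨z, hz, rfl⟩ := hC
  have hz' := mem_cutDisc_iff.1 hz
  obtain ⟨x, hx⟩ := closure_nonempty_iff.1 ⟨y, hy⟩
  rw [connectedComponentIn_cutDisc hz] at hx ⊢
  have hxr : x ∈ regularPoints α n :=
    (mem_regularPoints_iff hα).2 fun u hu => by rw [hx.2 u hu]; exact hz'.2 u hu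
  refine ⟨x, hxr, ?_⟩
  congr 1
  ext y
  simp only [sideClass, Set.mem_ofPred_eq, Circle.norm_coe, le_refl, true_and,
    mem_regularPoints_iff hα]
  constructor
  · intro h
    exact ⟨fun u hu => by rw [h u hu]; exact hz'.2 u hu,
      fun u hu => (h u hu).trans (hx.2 u hu).symm⟩
  · intro h u hu
    exact (h.2 u hu).trans (hx.2 u hu)

theorem finite_setOf_length_eq (n : ℕ) : {u : List Letter | u.length = n}.Finite := by
  have : Finite Letter := Finite.of_injective (fun l => match l with
    | Letter.L => true
    | Letter.R => false) (by intro a b; cases a <;> cases b <;> simp)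
  exact List.finite_length_eq Letter n

theorem isOpen_sideClass {α : Circle} (hα : Aperiodic α) (n : ℕ) (x : Circle)  :
    IsOpen (sideClass α n x) := by
  have h : sideClass α n x = ⋂ u ∈ {u : List Letter | u.length = n},
      {y : Circle | wordSign α u y ≠ 0 ∧ wordSign α u y = wordSign α u x} := by
    ext y
    simp only [sideClass, mem_regularPoints_iff hα, SameSide, Set.mem_ofPred_eq, Set.mem_iInter]
    exact ⟨fun h u hu => ⟨h.1 u hu, h.2 u hu⟩,
      fun h => ⟨fun u hu => (h u hu).1, fun u hu => (h u hu).2⟩⟩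
  rw [h]
  refine (finite_setOf_length_eq n).isOpen_biInter fun u _ => ?_
  have hc : Continuous fun y : Circle =>
      side (wordMap α u (star₁ α)) (wordMap α u (star₂ α)) (y : ℂ) :=
    (continuous_side _ _).comp continuous_subtype_val
  unfold wordSign
  generalize SignType.sign (side (wordMap α u (star₁ α)) (wordMap α u (star₂ α)) (x : ℂ)) = σ
  cases σ
  · convert isOpen_empty
    ext y
    simp only [Set.mem_ofPred_eq, Set.mem_empty_iff_false, iff_false, not_and]
    exact fun h1 h2 => h1 h2
  · convert isOpen_lt hc continuous_const using 1
    ext y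
    rw [Set.mem_ofPred_eq, Set.mem_ofPred_eq, show (SignType.neg = (-1 : SignType)) from rfl,
      sign_eq_neg_one_iff, Ne, sign_eq_zero_iff]
    exact ⟨fun h => h.2, fun h => ⟨h.ne, h⟩⟩
  · convert isOpen_lt continuous_const hc using 1
    ext y
    rw [Set.mem_ofPred_eq, Set.mem_ofPred_eq, show (SignType.pos = (1 : SignType)) from rfl,
      sign_eq_one_iff, Ne, sign_eq_zero_iff]
    exact ⟨fun h => h.2, fun h => ⟨h.ne', h⟩⟩

/-- Side classes are open, so taking the closure adds no regular points. -/
theorem mem_closure_sideClass_iff {α : Circle} (hα : Aperiodic α) {n : ℕ} {x y : Circle}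
    (hy : y ∈ regularPoints α n) : y ∈ closure (sideClass α n x) ↔ SameSide α n y x := by
  constructor
  · intro h
    obtain ⟨w, hw1, hw2⟩ := mem_closure_iff.1 h _ (isOpen_sideClass hα n y)
      ⟨hy, fun _ _ => rfl⟩
    exact hw1.2.symm.trans hw2.2
  · exact fun h => subset_closure ⟨hy, h⟩

/-! ### Generalized cylinder sets are gluing links -/

theorem hop_iterate_exp (k : ℕ) (t : ℝ) : hop^[k] (Circle.exp t) = Circle.exp (2 ^ k * t) := by
  induction k generalizing t with
  | zero => simp
  | succ k ih =>
    rw [Function.iterate_succ_apply, show hop (Circle.exp t) = Circle.exp (2 * t) from exp_sq t, ih]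
    congr 1
    ring

/-- The arguments of the preimages of `exp θ` under `hop^[n + 1]`. -/
noncomputable def preimageArg (θ : ℝ) (n k : ℕ) : ℝ := (θ + 2 * Real.pi * k) / 2 ^ (n + 1)

theorem preimageArg_add (θ : ℝ) (n k : ℕ) :
    preimageArg θ n (k + 2 ^ (n + 1)) = preimageArg θ n k + 2 * Real.pi := by
  unfold preimageArg
  push_cast
  field_simp
  ring

theorem preimageArg_strictMono (θ : ℝ) (n : ℕ) : StrictMono (preimageArg θ n) := by
  intro i j hij
  unfold preimageArg
  have h : (i : ℝ) < j := by exact_mod_cast hij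
  have hpi := Real.pi_pos
  gcongr

theorem hop_iterate_exp_preimageArg (θ : ℝ) (n k : ℕ) :
    hop^[n + 1] (Circle.exp (preimageArg θ n k)) = Circle.exp θ := by
  rw [hop_iterate_exp, preimageArg, Circle.exp_eq_exp]
  refine ⟨k, ?_⟩
  push_cast
  field_simp

theorem exp_mem_regularPoints {θ t : ℝ} {n k : ℕ} (h1 : preimageArg θ n k < t)
    (h2 : t < preimageArg θ n (k + 1)) : Circle.exp t ∈ regularPoints (Circle.exp θ) n := by
  intro h
  rw [hop_iterate_exp, Circle.exp_eq_exp] at h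
  obtain ⟨m, hm⟩ := h
  have hpi := Real.pi_pos
  unfold preimageArg at h1 h2
  rw [div_lt_iff₀ (by positivity)] at h1
  rw [lt_div_iff₀ (by positivity)] at h2
  push_cast at h2
  have h3 : (k : ℝ) < m := by nlinarith
  have h4 : (m : ℝ) < k + 1 := by nlinarith
  have h5 : (k : ℤ) < m := by exact_mod_cast h3
  have h6 : m < (k : ℤ) + 1 := by exact_mod_cast h4
  omega

theorem exists_preimageArg_le (θ : ℝ) (n N : ℕ) (x : Circle) :
    ∃ k, N ≤ k ∧ k < N + 2 ^ (n + 1) ∧ ∃ t, preimageArg θ n k ≤ t ∧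
      t < preimageArg θ n (k + 1) ∧ x = Circle.exp t := by
  obtain ⟨t', rfl⟩ := exists_exp_eq x
  have hmem := toIcoMod_mem_Ico Real.two_pi_pos (preimageArg θ n N) t'
  set t := toIcoMod Real.two_pi_pos (preimageArg θ n N) t' with ht
  have hexp : Circle.exp t' = Circle.exp t := by
    rw [Circle.exp_eq_exp]
    refine ⟨toIcoDiv Real.two_pi_pos (preimageArg θ n N) t', ?_⟩
    have := toIcoMod_add_toIcoDiv_zsmul Real.two_pi_pos (preimageArg θ n N) t'
    rw [zsmul_eq_mul, ← ht] at this
    exact this.symm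
  rw [← preimageArg_add] at hmem
  have hex : ∃ k, t < preimageArg θ n (k + 1) :=
    ⟨N + 2 ^ (n + 1), hmem.2.trans (preimageArg_strictMono θ n (Nat.lt_succ_self _))⟩
  classical
  have hspec := Nat.find_spec hex
  set k := Nat.find hex with hk
  have hNk : N < k + 1 := (preimageArg_strictMono θ n).lt_iff_lt.1 (hmem.1.trans_lt hspec)
  have hkt : preimageArg θ n k ≤ t := by
    rcases Nat.lt_or_ge N k with h | h
    · have := Nat.find_min hex (show k - 1 < k by omega)
      rw [Nat.sub_add_cancel (by omega)] at this
      exact not_lt.1 this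
    · rw [show k = N by omega]
      exact hmem.1
  exact ⟨k, by omega, (preimageArg_strictMono θ n).lt_iff_lt.1 (hkt.trans_lt hmem.2), t, hkt,
    hspec, hexp⟩

/-- The midpoint of the arc between two consecutive preimages. -/
noncomputable def arcMid (θ : ℝ) (n k : ℕ) : ℝ := (preimageArg θ n k + preimageArg θ n (k + 1)) / 2

theorem preimageArg_lt_arcMid (θ : ℝ) (n k : ℕ) : preimageArg θ n k < arcMid θ n k := by
  have := preimageArg_strictMono θ n (Nat.lt_succ_self k)
  unfold arcMid
  simp only [Nat.succ_eq_add_one] at this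
  linarith

theorem arcMid_lt_preimageArg (θ : ℝ) (n k : ℕ) : arcMid θ n k < preimageArg θ n (k + 1) := by
  have := preimageArg_strictMono θ n (Nat.lt_succ_self k)
  unfold arcMid
  simp only [Nat.succ_eq_add_one] at this
  linarith

theorem wordSign_exp_eq {α : Circle} {u : List Letter} {s : Set ℝ} (hs : IsPreconnected s)
    (h0 : ∀ t ∈ s, wordSign α u (Circle.exp t) ≠ 0) {t t' : ℝ} (ht : t ∈ s) (ht' : t' ∈ s) :
    wordSign α u (Circle.exp t) = wordSign α u (Circle.exp t') := by
  refine sign_eq_of_isPreconnected (f := fun t : ℝ =>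
    side (wordMap α u (star₁ α)) (wordMap α u (star₂ α)) (Circle.exp t)) hs ?_ ?_ ht ht'
  · exact ((continuous_side _ _).comp
      (continuous_subtype_val.comp Circle.exp.continuous)).continuousOn
  · intro x hx
    have := h0 x hx
    rwa [wordSign, Ne, sign_eq_zero_iff] at this

theorem sameSide_arcMid {θ : ℝ} {n k : ℕ} (hα : Aperiodic (Circle.exp θ)) {t : ℝ}
    (h1 : preimageArg θ n k < t) (h2 : t < preimageArg θ n (k + 1)) :
    SameSide (Circle.exp θ) n (Circle.exp t) (Circle.exp (arcMid θ n k)) := by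
  intro u hu
  refine wordSign_exp_eq (s := Set.Ioo (preimageArg θ n k) (preimageArg θ n (k + 1)))
    isPreconnected_Ioo (fun t ht => ?_) ⟨h1, h2⟩
    ⟨preimageArg_lt_arcMid θ n k, arcMid_lt_preimageArg θ n k⟩
  exact (mem_regularPoints_iff hα).1 (exp_mem_regularPoints ht.1 ht.2) u hu

/-- After an arc of a class, the next arc of this class, counterclockwise, begins at the other end
of the geodesic that begins at the end of the first arc. -/
theorem exists_next_arc {θ : ℝ} (hα : Aperiodic (Circle.exp θ)) (n k : ℕ) :
    ∃ k', k + 1 < k' ∧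
      SameSide (Circle.exp θ) n (Circle.exp (arcMid θ n k')) (Circle.exp (arcMid θ n k)) ∧
      (∀ i, k < i → i < k' →
        ¬ SameSide (Circle.exp θ) n (Circle.exp (arcMid θ n i)) (Circle.exp (arcMid θ n k))) ∧
      Glued (Circle.exp θ) (Circle.exp (preimageArg θ n (k + 1)))
        (Circle.exp (preimageArg θ n k')) := by
  set α := Circle.exp θ with hαθ
  obtain ⟨u, hu, hv⟩ := exists_wordMap_eq hα (hop_iterate_exp_preimageArg θ n (k + 1))
  set v := Circle.exp (preimageArg θ n (k + 1)) with hv_def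
  -- `v'` is the other end of the geodesic through `v`. Since `v` may come from `⋆₁` or from `⋆₂`,
  -- the side function is known only up to sign.
  obtain ⟨v', hv'α, hv'ne, hglue, hside, hother⟩ : ∃ v' : Circle, hop^[n + 1] v' = α ∧ v' ≠ v ∧
      Glued α v v' ∧
      ((∀ z : ℂ, wordSign α u z = SignType.sign (side v v' z)) ∨
        (∀ z : ℂ, wordSign α u z = -SignType.sign (side v v' z))) ∧
      (∀ u' : List Letter, u'.length = n → u ≠ u' →
        wordSign α u' v = wordSign α u' v' ∧ wordSign α u' v ≠ 0) := by
    rcases hv with hv | hv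
    · refine ⟨wordMap α u (star₂ α), ?_, ?_, ?_, Or.inl fun z => ?_, fun u' hu' hne => ?_⟩
      · rw [← hu]; exact hop_iterate_wordMap_star₂ α u
      · rw [hv]; exact (wordMap_star₁_ne α u).symm
      · rw [hv]; exact fun m _ => Or.inl (letter_iterate_endpoints hα u (m - 1))
      · rw [hv]; rfl
      · rw [hv]; exact wordSign_endpoints hα (hu.trans hu'.symm) hne
    · refine ⟨wordMap α u (star₁ α), ?_, ?_, ?_, Or.inr fun z => ?_, fun u' hu' hne => ?_⟩
      · rw [← hu]; exact hop_iterate_wordMap_star₁ α u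
      · rw [hv]; exact wordMap_star₁_ne α u
      · rw [hv]; exact fun m _ => Or.inl (letter_iterate_endpoints hα u (m - 1)).symm
      · rw [hv, side_swap, Left.sign_neg, neg_neg]; rfl
      · rw [hv]
        have h := wordSign_endpoints hα (hu.trans hu'.symm) hne
        exact ⟨h.1.symm, h.1 ▸ h.2⟩
  obtain ⟨k', hk1, hk2, t, ht1, ht2, hvt⟩ := exists_preimageArg_le θ n (k + 1) v'
  have htk : preimageArg θ n k' = t := by
    by_contra hne
    have hreg := exp_mem_regularPoints (lt_of_le_of_ne ht1 hne) ht2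
    rw [← hvt] at hreg
    exact hreg hv'α
  rw [← htk] at hvt
  have hk1' : k + 1 < k' := by
    refine lt_of_le_of_ne hk1 fun h => hv'ne ?_
    rw [hvt, hv_def, h]
  have hmono := preimageArg_strictMono θ n
  have hk2' : preimageArg θ n (k' + 1) ≤ preimageArg θ n (k + 1) + 2 * Real.pi := by
    rw [← preimageArg_add]
    exact hmono.monotone (by omega)
  have hk2'' : preimageArg θ n k' ≤ preimageArg θ n k + 2 * Real.pi := by
    rw [← preimageArg_add]
    exact hmono.monotone (by omega)
  have hAB := hmono hk1'
  have hpos : 0 < Real.sin ((preimageArg θ n k' - preimageArg θ n (k + 1)) / 2) := by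
    have := hmono (Nat.lt_succ_self k')
    simp only [Nat.succ_eq_add_one] at this
    exact Real.sin_pos_of_pos_of_lt_pi (by linarith) (by linarith)
  -- The geodesic from `v` to `v'` has the arcs `k` and `k'` on one side and all arcs between them
  -- on the other.
  have hside_k : 0 < side v v' (Circle.exp (arcMid θ n k)) := by
    have h1 := preimageArg_lt_arcMid θ n k
    have h2 := arcMid_lt_preimageArg θ n k
    rw [hvt, hv_def, side_exp]
    have e1 : Real.sin ((arcMid θ n k - preimageArg θ n k') / 2) < 0 :=
      Real.sin_neg_of_neg_of_neg_pi_lt (by linarith) (by linarith)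
    have e2 : 0 < Real.sin ((preimageArg θ n (k + 1) - arcMid θ n k) / 2) :=
      Real.sin_pos_of_pos_of_lt_pi (by linarith) (by linarith)
    exact mul_pos (mul_pos_of_neg_of_neg (by linarith) e1) e2
  have hside_k' : 0 < side v v' (Circle.exp (arcMid θ n k')) := by
    have h1 := preimageArg_lt_arcMid θ n k'
    have h2 := arcMid_lt_preimageArg θ n k'
    rw [hvt, hv_def, side_exp]
    have e1 : 0 < Real.sin ((arcMid θ n k' - preimageArg θ n k') / 2) :=
      Real.sin_pos_of_pos_of_lt_pi (by linarith) (by linarith)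
    have e2 : Real.sin ((preimageArg θ n (k + 1) - arcMid θ n k') / 2) < 0 :=
      Real.sin_neg_of_neg_of_neg_pi_lt (by linarith) (by linarith)
    exact mul_pos_of_neg_of_neg (mul_neg_of_neg_of_pos (by linarith) e1) e2
  have hside_i : ∀ i, k < i → i < k' → side v v' (Circle.exp (arcMid θ n i)) < 0 := by
    intro i hi1 hi2
    have h1 := preimageArg_lt_arcMid θ n i
    have h2 := arcMid_lt_preimageArg θ n i
    have h3 := hmono.monotone (show k + 1 ≤ i from hi1)
    have h4 := hmono.monotone (show i + 1 ≤ k' from hi2)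
    rw [hvt, hv_def, side_exp]
    have h5 := hmono (Nat.lt_succ_self k')
    simp only [Nat.succ_eq_add_one] at h5
    have e1 : Real.sin ((arcMid θ n i - preimageArg θ n k') / 2) < 0 :=
      Real.sin_neg_of_neg_of_neg_pi_lt (by linarith) (by linarith)
    have e2 : Real.sin ((preimageArg θ n (k + 1) - arcMid θ n i) / 2) < 0 :=
      Real.sin_neg_of_neg_of_neg_pi_lt (by linarith) (by linarith)
    exact mul_neg_of_pos_of_neg (mul_pos_of_neg_of_neg (by linarith) e1) e2
  refine ⟨k', hk1', ?_, ?_, hvt ▸ hglue⟩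
  · intro u' hu'
    by_cases huu : u = u'
    · subst huu
      rcases hside with h | h <;> rw [h, h, sign_pos hside_k, sign_pos hside_k']
    -- Any other geodesic has `v` and `v'` strictly on one side, and each arc shares that side with
    -- its adjacent end.
    · obtain ⟨h1, h2⟩ := hother u' hu' huu
      have e1 : wordSign α u' (Circle.exp (arcMid θ n k)) = wordSign α u' v := by
        refine wordSign_exp_eq (s := Set.Ioc (preimageArg θ n k) (preimageArg θ n (k + 1)))
          isPreconnected_Ioc (fun t ht => ?_)
          ⟨preimageArg_lt_arcMid θ n k, (arcMid_lt_preimageArg θ n k).le⟩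
          ⟨hmono (Nat.lt_succ_self k), le_rfl⟩
        rcases ht.2.eq_or_lt with h3 | h3
        · rw [h3]; exact h2
        · exact (mem_regularPoints_iff hα).1 (exp_mem_regularPoints ht.1 h3) u' hu'
      have e2 : wordSign α u' (Circle.exp (arcMid θ n k')) = wordSign α u' v' := by
        rw [hvt]
        refine wordSign_exp_eq (s := Set.Ico (preimageArg θ n k') (preimageArg θ n (k' + 1)))
          isPreconnected_Ico (fun t ht => ?_)
          ⟨(preimageArg_lt_arcMid θ n k').le, arcMid_lt_preimageArg θ n k'⟩
          ⟨le_rfl, hmono (Nat.lt_succ_self k')⟩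
        rcases ht.1.eq_or_lt with h3 | h3
        · rw [← h3, ← hvt, ← h1]; exact h2
        · exact (mem_regularPoints_iff hα).1 (exp_mem_regularPoints h3 ht.2) u' hu'
      rw [e1, e2, h1]
  · intro i hi1 hi2 hs
    have h1 := hs u hu
    rcases hside with h | h <;>
      · rw [h, h, sign_pos hside_k, sign_neg (hside_i i hi1 hi2)] at h1
        revert h1
        decide

theorem exp_mem_of_lt {θ : ℝ} {n k : ℕ} (hα : Aperiodic (Circle.exp θ)) {x : Circle}
    (hk : SameSide (Circle.exp θ) n (Circle.exp (arcMid θ n k)) x) {t : ℝ}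
    (h1 : preimageArg θ n k < t) (h2 : t < preimageArg θ n (k + 1)) :
    Circle.exp t ∈ sideClass (Circle.exp θ) n x :=
  ⟨exp_mem_regularPoints h1 h2, (sameSide_arcMid hα h1 h2).trans hk⟩

/-- On the real line the arcs of the class recur with index period `2 ^ (n + 1)`. `Nat.nth p` lists
them in order, `exists_next_arc` glues neighbours, and one full turn closes the list up. -/
theorem isGluingLink_closure_sideClass {α : Circle} (hα : Aperiodic α) {n : ℕ} {x : Circle}
    (hx : x ∈ regularPoints α n) : IsGluingLink α (closure (sideClass α n x)) := by
  classical
  obtain ⟨θ, rfl⟩ := exists_exp_eq α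
  let p : ℕ → Prop := fun k => SameSide (Circle.exp θ) n (Circle.exp (arcMid θ n k)) x
  have harc : ∀ y ∈ sideClass (Circle.exp θ) n x, ∀ N, ∃ k, N ≤ k ∧ k < N + 2 ^ (n + 1) ∧ p k ∧
      ∃ t, preimageArg θ n k < t ∧ t < preimageArg θ n (k + 1) ∧ y = Circle.exp t := by
    rintro y ⟨hy, hyx⟩ N
    obtain ⟨k, hk1, hk2, t, ht1, ht2, rfl⟩ := exists_preimageArg_le θ n N y
    have ht : preimageArg θ n k < t := by
      refine lt_of_le_of_ne ht1 fun h => hy ?_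
      rw [← h]
      exact hop_iterate_exp_preimageArg θ n k
    exact ⟨k, hk1, hk2, (sameSide_arcMid hα ht ht2).symm.trans hyx, t, ht, ht2, rfl⟩
  have hinf : (Set.ofPred p).Infinite := by
    refine Nat.frequently_atTop_iff_infinite.1 (Filter.frequently_atTop.2 fun N => ?_)
    obtain ⟨k, hk1, -, hk, -⟩ := harc x ⟨hx, fun _ _ => rfl⟩ N
    exact ⟨k, hk1, hk⟩
  have hp : ∀ j, p (Nat.nth p j) := fun j => Nat.nth_mem_of_infinite hinf j
  have hmono := preimageArg_strictMono θ n
  have hper : ∀ k, p k → p (k + 2 ^ (n + 1)) := by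
    intro k hk
    have : Circle.exp (arcMid θ n (k + 2 ^ (n + 1))) = Circle.exp (arcMid θ n k) := by
      rw [Circle.exp_eq_exp]
      refine ⟨1, ?_⟩
      rw [arcMid, arcMid, add_right_comm, preimageArg_add, preimageArg_add]
      push_cast
      ring
    simp only [p, this]
    exact hk
  have hnext : ∀ j, Nat.nth p j + 1 < Nat.nth p (j + 1) ∧
      Glued (Circle.exp θ) (Circle.exp (preimageArg θ n (Nat.nth p j + 1)))
        (Circle.exp (preimageArg θ n (Nat.nth p (j + 1)))) := by
    intro j
    obtain ⟨k', h1, h2, h3, h4⟩ := exists_next_arc hα n (Nat.nth p j)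
    have hk' : p k' := h2.trans (hp j)
    have hlt : Nat.nth p j < Nat.nth p (j + 1) := Nat.nth_strictMono hinf (Nat.lt_succ_self j)
    have heq : Nat.nth p (j + 1) = k' := by
      apply le_antisymm
      · rw [← Nat.nth_count hk']
        refine (Nat.nth_strictMono hinf).monotone ?_
        rw [Nat.succ_le_iff, ← (Nat.nth_strictMono hinf).lt_iff_lt, Nat.nth_count hk']
        omega
      · by_contra hcon
        exact h3 _ hlt (not_le.1 hcon) ((hp (j + 1)).trans (hp j).symm)
    rw [heq]
    exact ⟨h1, h4⟩
  have hm : Nat.nth p (Nat.count p (Nat.nth p 0 + 2 ^ (n + 1))) = Nat.nth p 0 + 2 ^ (n + 1) :=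
    Nat.nth_count (hper _ (hp 0))
  refine ⟨Nat.count p (Nat.nth p 0 + 2 ^ (n + 1)), fun j => preimageArg θ n (Nat.nth p j),
    fun j => preimageArg θ n (Nat.nth p j + 1), ?_, fun j _ => ⟨?_, ?_, (hnext j).2⟩, ?_⟩
  · simp only [hm, preimageArg_add]
  · exact (hmono (Nat.lt_succ_self _)).le
  · exact hmono (hnext j).1
  · apply Set.Subset.antisymm
    · refine closure_minimal ?_ ?_
      · intro y hy
        obtain ⟨k, hk1, hk2, hk, t, ht1, ht2, rfl⟩ := harc y hy (Nat.nth p 0)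
        simp only [Set.mem_iUnion]
        refine ⟨Nat.count p k, Nat.count_strict_mono hk hk2, t, ?_, rfl⟩
        simp only [Nat.nth_count hk]
        exact ⟨ht1.le, ht2.le⟩
      · refine (Set.finite_lt_nat _).isClosed_biUnion fun j _ => ?_
        exact (isCompact_Icc.image Circle.exp.continuous).isClosed
    · simp only [Set.iUnion_subset_iff]
      intro j _
      have hlt := hmono (Nat.lt_succ_self (Nat.nth p j))
      rw [← closure_Ioo hlt.ne]
      refine (image_closure_subset_closure_image Circle.exp.continuous).trans (closure_mono ?_)
      rintro _ ⟨t, ht, rfl⟩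
      exact exp_mem_of_lt hα (hp j) ht.1 ht.2

/-! ### Digit-fixing covers -/

theorem eq_closure_sideClass {α : Circle} (hα : Aperiodic α) {n : ℕ} {C : Set Circle}
    (hC : C ∈ GCS α n) {y : Circle} (hy : y ∈ C) (hyr : y ∈ regularPoints α n) :
    C = closure (sideClass α n y) := by
  obtain ⟨x, hx, rfl⟩ := exists_eq_closure_sideClass hα hC hy
  have h := (mem_closure_sideClass_iff hα hyr).1 hy
  congr 1
  ext z
  exact ⟨fun hz => ⟨hz.1, hz.2.trans h.symm⟩, fun hz => ⟨hz.1, hz.2.trans h⟩⟩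

theorem sameSide_of_mem_GCS {α : Circle} (hα : Aperiodic α) {n : ℕ} {C : Set Circle}
    (hC : C ∈ GCS α n) {x y : Circle} (hx : x ∈ C) (hy : y ∈ C) (hxr : x ∈ regularPoints α n)
    (hyr : y ∈ regularPoints α n) : SameSide α n x y := by
  rw [eq_closure_sideClass hα hC hy hyr] at hx
  exact (mem_closure_sideClass_iff hα hxr).1 hx

/-- An end point of level `n` reaches `α` after `n + 1` steps, so by aperiodicity it is regular at
level `n + 1`. Two consecutive levels therefore cover the circle. -/
theorem exists_mem_GCS {α : Circle} (hα : Aperiodic α) (n : ℕ) (x : Circle) :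
    ∃ C ∈ GCS α n ∪ GCS α (n + 1), x ∈ C := by
  by_cases hx : x ∈ regularPoints α n
  · exact ⟨_, Or.inl (closure_sideClass_mem_GCS hα hx), subset_closure ⟨hx, fun _ _ => rfl⟩⟩
  · have hx' : x ∈ regularPoints α (n + 1) := by
      intro h
      rw [Function.iterate_succ_apply', not_not.1 hx] at h
      exact hα 0 h
    exact ⟨_, Or.inr (closure_sideClass_mem_GCS hα hx'), subset_closure ⟨hx', fun _ _ => rfl⟩⟩

theorem isOpen_setOf_letter_eq (α : Circle) (l : Letter) :
    IsOpen {x | letter α x = some l} := by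
  simp only [letter_eq_some_iff, div_eq_mul_inv]
  refine isOpen_lt continuous_const (Complex.continuous_im.comp ?_)
  exact continuous_subtype_val.comp (continuous_id.mul continuous_const)

/-- Near a point of the closure of a class there is a point of the class with the same letter. -/
theorem exists_letter_eq_of_mem_closure {α : Circle} (hα : Aperiodic α) {n : ℕ} {x y : Circle}
    (hy : y ∈ closure (sideClass α (n + 1) x)) :
    ∃ z ∈ sideClass α (n + 1) x, letter α z = letter α y := by
  rcases hl : letter α y with _ | l
  · have hyr : y ∈ regularPoints α (n + 1) := by
      intro h
      rw [Function.iterate_succ_apply, letter_eq_none_iff.1 hl] at h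
      exact hα _ h
    exact ⟨y, ⟨hyr, (mem_closure_sideClass_iff hα hyr).1 hy⟩, hl⟩
  · obtain ⟨z, hz1, hz2⟩ := mem_closure_iff.1 hy _ (isOpen_setOf_letter_eq α l) hl
    exact ⟨z, hz2, hz1⟩

/-- If two points of a generalized cylinder set have different letters, then its image is on the
same side as `α` of all geodesics. -/
theorem sameSide_hop_alpha_of_mem_GCS {α : Circle} (hα : Aperiodic α) {n : ℕ} {C : Set Circle}
    (hC : C ∈ GCS α (n + 1)) {x y z : Circle} (hx : x ∈ C) (hy : y ∈ C)
    (hxy : letter α x ≠ letter α y) (hz : z ∈ C) (hzr : z ∈ regularPoints α (n + 1)) :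
    SameSide α n (hop z) α := by
  rw [eq_closure_sideClass hα hC hz hzr] at hx hy
  obtain ⟨x', hx', hxl⟩ := exists_letter_eq_of_mem_closure hα hx
  obtain ⟨y', hy', hyl⟩ := exists_letter_eq_of_mem_closure hα hy
  have h1 : SameSide α n (hop x') α :=
    (hx'.2.trans hy'.2.symm).hop_alpha hα (by rwa [hxl, hyl])
  exact (SameSide.hop hα hx'.2.symm).trans h1

theorem hop_mem_pullbackCover {α : Circle} {D : Circle → Set Circle} {n : ℕ} {x y : Circle}
    (h : x ∈ pullbackCover α D (n + 1) y) : hop x ∈ pullbackCover α D n (hop y) := h.1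

theorem hop_iterate_mem_pullbackCover {α : Circle} {D : Circle → Set Circle} {n k : ℕ}
    {x y : Circle} (h : x ∈ pullbackCover α D (n + k) y) :
    hop^[k] x ∈ pullbackCover α D n (hop^[k] y) := by
  induction k generalizing x y with
  | zero => exact h
  | succ k ih =>
    rw [Function.iterate_succ_apply, Function.iterate_succ_apply]
    exact ih (hop_mem_pullbackCover h)

/-- Each pull-back raises the level by one. When the set contains `α`, that point, regular at every
level, is itself available for comparison. -/
theorem sameSide_of_mem_pullbackCover {α : Circle} (hα : Aperiodic α) {C : Circle → Set Circle}
    {K m : ℕ} {y : Circle} (hC : C (hop^[m] y) ∈ GCS α K) {x₁ x₂ : Circle}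
    (h1 : x₁ ∈ pullbackCover α C m y) (h2 : x₂ ∈ pullbackCover α C m y)
    (hr1 : x₁ ∈ regularPoints α (K + m)) (hr2 : x₂ ∈ regularPoints α (K + m)) :
    SameSide α (K + m) x₁ x₂ := by
  induction m generalizing y x₁ x₂ with
  | zero => exact sameSide_of_mem_GCS hα hC h1 h2 hr1 hr2
  | succ m ih =>
    rw [Function.iterate_succ_apply] at hC
    have hreg : ∀ x, x ∈ regularPoints α (K + (m + 1)) → hop x ∈ regularPoints α (K + m) :=
      fun x hx h => hx (by rw [← h, ← Function.iterate_succ_apply]; rfl)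
    refine SameSide.of_hop hα (ih hC h1.1 h2.1 (hreg _ hr1) (hreg _ hr2)) ?_
    rcases h1.2 with h | h
    · exact Or.inr (ih hC h1.1 h (hreg _ hr1) (alpha_mem_regularPoints hα _ 0))
    · rcases h2.2 with h' | h'
      · exact Or.inr (ih hC h1.1 h' (hreg _ hr1) (alpha_mem_regularPoints hα _ 0))
      · exact Or.inl (h.trans h'.symm)

/-- At a digit where two points of a pulled back set differ, the image of this set contains `α`. -/
theorem alpha_mem_pullbackCover {α : Circle} {C : Circle → Set Circle} {n : ℕ} {y x₁ x₂ : Circle}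
    (h1 : x₁ ∈ pullbackCover α C (n + 1) y) (h2 : x₂ ∈ pullbackCover α C (n + 1) y)
    (hl : letter α x₁ ≠ letter α x₂) : α ∈ pullbackCover α C n (hop y) := by
  rcases h1.2 with h | h
  · exact h
  · rcases h2.2 with h' | h'
    · exact h'
    · exact absurd (h.trans h'.symm) hl

/-- A difference at position `i` puts `α` into the image set there, hence `hop^[j - i] α` into the
one at position `j`, which also contains `α`. If `j = n + 1`, no pull-back is left: the cover set
itself contains two letters, and only its image, one level lower, can be compared with `α`. Hence
the cover starts at level `K + 1`. -/
theorem isDigitFixingCover_of_separated {α : Circle} (hα : Aperiodic α) {N K : ℕ}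
    (hsep : ∀ n, K ≤ n → ∀ i, 1 ≤ i → i ≤ N → ¬ SameSide α n (hop^[i] α) α)
    {C : Circle → Set Circle}
    (hC : ∀ x, C x ∈ GCS α (K + 1) ∪ GCS α (K + 1 + 1) ∧ x ∈ C x) :
    IsDigitFixingCover α N C := by
  refine ⟨fun x => ?_, fun x => (hC x).2, ?_⟩
  · rcases (hC x).1 with h | h
    · obtain ⟨z, hz, h'⟩ := exists_eq_closure_sideClass hα h (hC x).2
      rw [h']
      exact isGluingLink_closure_sideClass hα hz
    · obtain ⟨z, hz, h'⟩ := exists_eq_closure_sideClass hα h (hC x).2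
      rw [h']
      exact isGluingLink_closure_sideClass hα hz
  · intro n y x₁ x₂ h1 h2 i j hi hij hj hdi hdj
    by_contra hN
    have hji : hop^[j - i] α = hop (hop^[j - 1 - i] α) := by
      rw [← Function.iterate_succ_apply' hop]
      congr 2
      omega
    have hpull : ∀ k ≤ n, ∀ x ∈ pullbackCover α C n y,
        hop^[k] x ∈ pullbackCover α C (n - k) (hop^[k] y) := by
      intro k hk x hx
      refine hop_iterate_mem_pullbackCover ?_
      rwa [Nat.sub_add_cancel hk]
    have halpha : ∀ k, 1 ≤ k → k ≤ n → itin α x₁ k ≠ itin α x₂ k →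
        α ∈ pullbackCover α C (n - k) (hop^[k] y) := by
      intro k hk1 hk hd
      have e1 := hpull (k - 1) (by omega) x₁ h1
      have e2 := hpull (k - 1) (by omega) x₂ h2
      rw [show n - (k - 1) = n - k + 1 by omega] at e1 e2
      have := alpha_mem_pullbackCover e1 e2 hd
      rwa [← Function.iterate_succ_apply' hop, show (k - 1).succ = k by omega] at this
    have hαi := halpha i hi (by omega) hdi
    have hαj : ∀ s, i + s ≤ n → hop^[s] α ∈ pullbackCover α C (n - (i + s)) (hop^[i + s] y) := by
      intro s hs
      rw [show n - i = n - (i + s) + s by omega] at hαi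
      have := hop_iterate_mem_pullbackCover hαi
      rwa [← Function.iterate_add_apply, add_comm s i] at this
    rcases Nat.lt_or_ge n j with hnj | hnj
    · obtain rfl : j = n + 1 := by omega
      have e0 := hαj (n - i) (by omega)
      have e1 := hpull n le_rfl x₁ h1
      have e2 := hpull n le_rfl x₂ h2
      rw [show i + (n - i) = n by omega] at e0
      rw [Nat.sub_self] at e0 e1 e2
      rw [show n + 1 - 1 - i = n - i by omega] at hji
      rcases (hC (hop^[n] y)).1 with h | h
      · refine hsep K le_rfl (n + 1 - i) (by omega) (by omega) ?_
        rw [hji]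
        exact sameSide_hop_alpha_of_mem_GCS hα h e1 e2 hdj e0 (alpha_mem_regularPoints hα _ _)
      · refine hsep (K + 1) (by omega) (n + 1 - i) (by omega) (by omega) ?_
        rw [hji]
        exact sameSide_hop_alpha_of_mem_GCS hα h e1 e2 hdj e0 (alpha_mem_regularPoints hα _ _)
    · have e0 := hαj (j - i) (by omega)
      rw [show i + (j - i) = j by omega] at e0
      have e1 := halpha j (by omega) hnj hdj
      rcases (hC (hop^[n - j] (hop^[j] y))).1 with h | h
      · exact hsep (K + 1 + (n - j)) (by omega) (j - i) (by omega) (by omega)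
          (sameSide_of_mem_pullbackCover hα h e0 e1 (alpha_mem_regularPoints hα _ _)
            (alpha_mem_regularPoints hα _ 0))
      · exact hsep (K + 1 + 1 + (n - j)) (by omega) (j - i) (by omega) (by omega)
          (sameSide_of_mem_pullbackCover hα h e0 e1 (alpha_mem_regularPoints hα _ _)
            (alpha_mem_regularPoints hα _ 0))

end QuadLam

theorem mainTheorem6 (α : Circle) (hSR : ¬ QuadLam.StronglyRecurrent α)
    (hWP : ¬ QuadLam.WeaklyPreperiodic α) (N : ℕ) :
    ∃ K : ℕ, 0 < K ∧
      (∀ n, K ≤ n →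
        (∃! C, C ∈ QuadLam.GCS α n ∧ α ∈ C) ∧
        ∀ C ∈ QuadLam.GCS α n, α ∈ C → ∀ i, 1 ≤ i → i ≤ N → QuadLam.hop^[i] α ∉ C) ∧
      (∀ x, ∃ C ∈ QuadLam.GCS α K ∪ QuadLam.GCS α (K + 1), x ∈ C) ∧
      ∀ C : Circle → Set Circle,
        (∀ x, C x ∈ QuadLam.GCS α K ∪ QuadLam.GCS α (K + 1) ∧ x ∈ C x) →
        QuadLam.IsDigitFixingCover α N C := by
  open QuadLam in
  have hα := aperiodic_of_not_weaklyPreperiodic hWP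
  obtain ⟨K, hK⟩ : ∃ K, ∀ n, K ≤ n → ∀ i, 1 ≤ i → i ≤ N → ¬ SameSide α n (hop^[i] α) α := by
    have h : ∀ᶠ n in Filter.atTop, ∀ i ∈ Finset.Icc 1 N, ¬ SameSide α n (hop^[i] α) α := by
      rw [Filter.eventually_all_finset]
      exact fun i hi => eventually_not_sameSide hWP (Finset.mem_Icc.1 hi).1
    obtain ⟨K, hK⟩ := Filter.eventually_atTop.1 h
    exact ⟨K, fun n hn i hi1 hi => hK n hn i (Finset.mem_Icc.2 ⟨hi1, hi⟩)⟩
  have hreg : ∀ n, α ∈ regularPoints α n := fun n => alpha_mem_regularPoints hα n 0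
  -- One level beyond the separation threshold, to pay for the comparison at the last digit.
  refine ⟨K + 1, Nat.succ_pos K, fun n hn => ⟨⟨closure (sideClass α n α),
    ⟨closure_sideClass_mem_GCS hα (hreg n), subset_closure ⟨hreg n, fun _ _ => rfl⟩⟩,
    fun C hC => eq_closure_sideClass hα hC.1 hC.2 (hreg n)⟩, fun C hC hαC i hi1 hi hiC => ?_⟩,
    exists_mem_GCS hα (K + 1), fun C hC => isDigitFixingCover_of_separated hα hK hC⟩
  exact hK n (by omega) i hi1 hi
    (sameSide_of_mem_GCS hα hC hiC hαC (alpha_mem_regularPoints hα n i) (hreg n))
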